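/- Let $n,l$ be integers with $2l>n$, and let $V(x)=\sum_{q\ne 0}v_q e^{i\langle q,x\rangle}$ be a real trigonometric polynomial on $\mathbb R^n$ (so $v_{-q}=\overline{v_q}$, only finitely many $v_q\neq0$, and $v_0=0$). For $j\in\mathbb Z^n$ and $t\in\mathbb R^n$ put $P_j(t)=j+t$, $p_j(t)=|P_j(t)|$, and let $K=[0,1)^n$. Functions $u$ with $u(x+2\pi e_s)=e^{2\pi i t_s}u(x)$ are expanded in the plane waves $e^{i\langle P_m(t),x\rangle}$, $m\in\mathbb Z^n$; for a periodic $W=\sum_m w_me^{i\langle m,x\rangle}$ put $\|W\|_*=\sum_m|w_m|$, and let $H_0(t)+W$ be the operator $(-\Delta)^l+W$ with these quasiperiodic conditions, written as a matrix in $\ell^2(\mathbb Z^n)$. Let $q$ satisfy $v_q\ne0$, and let $0<9\delta<2l-n$. For $k>0$, the resonant set $\chi_q(k,\delta)$ consists of the $t\in K$ for which there is a label $j$ with $p_j(t)=k$, $|p_{j-q}^2(t)-p_j^2(t)|<k^{-n+2-\delta}$, and $|p_j^2(t)-p_i^2(t)|>2k^{-n+2-6\delta}$, $|p_{j-q}^2(t)-p_i^2(t)|>2k^{-n+2-6\delta}$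 for all $i\ne j,j-q$. For $t\in K$ at distance less than $k^{-n+1-7\delta}$ from a point of $\chi_q(k,\delta)$ with label $j$, let $$\hat\lambda^{\pm}_j(t)=\tfrac12\big(p_j^{2l}(t)+p_{j-q}^{2l}(t)\big)\pm\tfrac12\Big(4|v_q|^2+\big(p_j^{2l}(t)-p_{j-q}^{2l}(t)\big)^2\Big)^{1/2}$$ be the eigenvalues of the model matrix $\begin{pmatrix}p_j^{2l}&v_q\\ v_{-q}&p_{j-q}^{2l}\end{pmatrix}$; this formula makes sense for all $t\in\mathbb R^n$. Fix a sign $\pm$, $\sigma\in\mathbb R$ and $A\in\mathbb C$. For a periodic potential $W$, let $E_W(t)$ be the spectral projection of $H_0(t)+W$ for the part of the spectrum at distance less than $|v_q|/10$ from $\hat\lambda_j^{\pm}(t)$, and put $\hat u_W(x)=A\sum_{m}(E_W(t))_{mj}e^{i\langle P_m(t),x\rangle}$. Let $W_0=V$ and $W_{m+1}=V+\sigma|\hat u_{W_m}|^2$. Theorem. There is a constant $C=C(V)>0$ (also depending on $n,l$) such that for all $\delta$ with $0<9\delta<2l-n$ and all $\gamma_2>0$ there is $R=R(V,\delta,\gamma_2)$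 for which the following holds for all $q$ with $v_q\neq0$, both signs $\pm$, all $k\ge R$, and all $\sigma\in\mathbb R$, $A\in\mathbb C$ with $|\sigma||A|^2<k^{-2l\gamma_2}$. (a) For all $t$ and $j$ as above, every $H_0(t)+W_m$ has exactly one eigenvalue, and that a simple one, at distance less than $|v_q|/10$ from $\hat\lambda^{\pm}_j(t)$; the $W_m$ converge in $\|\cdot\|_*$ to a periodic potential $W$; $H_0(t)+W$ has exactly one eigenvalue $\lambda_W(t)$, a simple one, at distance less than $|v_q|/10$ from $\hat\lambda_j^{\pm}(t)$; and $u=\hat u_W$ is a classical solution of $$(-\Delta)^lu+Vu+\sigma|u|^2u=\lambda_W(t)u,\qquad u(x+2\pi e_s)=e^{2\pi i t_s}u(x)\quad(x\in\mathbb R^n,\ s=1,\dots,n).$$ (b) For every $\lambda_0\ge R$, the isoenergetic surface $\lambda_W(t)=\lambda_0$ lies in the $C\lambda_0^{-\hat\gamma}$-neighborhood of the model surface $\hat\lambda^{\pm}(t)=\lambda_0$ with the same sign, where $\hat\gamma=\gamma/(2l)$, $\gamma=\min\{\gamma_1,2l\gamma_2\}$ and $2\gamma_1=2l-n-8\delta$.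 More precisely, if $t$ with label $j$ is as above and $\lambda_W(t)=\lambda_0$, then there is $t'\in\mathbb R^n$ with $\hat\lambda^{\pm}_j(t')=\lambda_0$ (same label $j$) and $|t-t'|<C\lambda_0^{-\hat\gamma}$. (Reducing $t'$ modulo $\mathbb Z^n$ gives a point of the model surface in $K\cong\mathbb R^n/\mathbb Z^n$.) -/

import Mathlib

noncomputable section

namespace ResonantPolyharmonic

open scoped ENNReal InnerProductSpace
open Filter Topology

/-- The space `ℝⁿ` with its Euclidean norm. -/
abbrev Rn (n : ℕ) : Type := EuclideanSpace ℝ (Fin n)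

/-- The index lattice `ℤⁿ`. -/
abbrev Lat (n : ℕ) : Type := Fin n → ℤ

/-- The Hilbert space `ℓ²(ℤⁿ)`. -/
abbrev Ell2 (n : ℕ) : Type := lp (fun _ : Lat n => ℂ) 2

/-- The elementary cell `K = [0,1)ⁿ` of quasimomenta. -/
def cellK (n : ℕ) : Set (Rn n) := {t | ∀ i, 0 ≤ t i ∧ t i < 1}

/-- The wave vector `P_j(t) = j + t`.  The plane waves `exp(i⟨P_j(t), x⟩)` are exactly those with
`u(x + 2π e_s) = exp(2π i t_s) u(x)`. -/
def waveVec {n : ℕ} (j : Lat n) (t : Rn n) : Rn n :=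
  WithLp.toLp 2 (fun i => (j i : ℝ) + t i)

/-- `p_j(t) = |P_j(t)|`. -/
def waveLen {n : ℕ} (j : Lat n) (t : Rn n) : ℝ := ‖waveVec j t‖

/-- The trigonometric polynomial `V(x) = ∑_q v_q exp(i⟨q, x⟩)`. -/
def trigPoly {n : ℕ} (v : Lat n →₀ ℂ) (x : Rn n) : ℂ :=
  v.sum fun q a => a * Complex.exp (Complex.I * ((⟪waveVec q 0, x⟫_ℝ : ℝ) : ℂ))

/-- `IsResonantPoint q k δ j t`: the quasimomentum `t ∈ K` belongs to the resonant set `χ_q(k,δ)`,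
and `j` is the corresponding label: `P_j(t)` lies on the sphere of radius `k`, the numbers
`p_j²(t)` and `p_{j-q}²(t)` are close to each other, and both are sufficiently far from
all the other `p_i²(t)`. -/
def IsResonantPoint {n : ℕ} (q : Lat n) (k δ : ℝ) (j : Lat n) (t : Rn n) : Prop :=
  t ∈ cellK n ∧ waveLen j t = k ∧
  |waveLen (j - q) t ^ 2 - waveLen j t ^ 2| < k ^ (-(n : ℝ) + 2 - δ) ∧
  ∀ i : Lat n, i ≠ j → i ≠ j - q →
    2 * k ^ (-(n : ℝ) + 2 - 6 * δ) < |waveLen j t ^ 2 - waveLen i t ^ 2| ∧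
    2 * k ^ (-(n : ℝ) + 2 - 6 * δ) < |waveLen (j - q) t ^ 2 - waveLen i t ^ 2|

/-- The `k^{-n+1-7δ}`-neighborhood in `K` of `χ_q(k,δ)`, near points with label `j`. -/
def resonantNhd {n : ℕ} (q : Lat n) (k δ : ℝ) (j : Lat n) : Set (Rn n) :=
  {t | t ∈ cellK n ∧
    ∃ t₀, IsResonantPoint q k δ j t₀ ∧ dist t t₀ < k ^ (-(n : ℝ) + 1 - 7 * δ)}

/-- The eigenvalues `λ̂^±(t) = a ± b` (sign `s = ±1`) of the model matrix
`!![p_j^{2l}(t), v_q; v_{-q}, p_{j-q}^{2l}(t)]`, for an arbitrary `t ∈ ℝⁿ`. -/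
def modelEigenvalue {n : ℕ} (l : ℕ) (v : Lat n →₀ ℂ) (q : Lat n) (s : ℤˣ) (j : Lat n)
    (t : Rn n) : ℝ :=
  (waveLen j t ^ (2 * l) + waveLen (j - q) t ^ (2 * l)) / 2 +
    ((s : ℤ) : ℝ) *
      (Real.sqrt (4 * ‖v q‖ ^ 2 + (waveLen j t ^ (2 * l) - waveLen (j - q) t ^ (2 * l)) ^ 2) / 2)

/-- `c ∈ ℓ²(ℤⁿ)` satisfies `(H₀(t) + W) c = μ c`, where the periodic potential `W` has the Fourier
coefficients `w` and functions are expanded in the basis `exp(i⟨P_m(t), x⟩)`. -/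
def IsEigenvector {n : ℕ} (l : ℕ) (t : Rn n) (w : Lat n → ℂ) (μ : ℝ) (c : Ell2 n) : Prop :=
  ∀ m : Lat n, ((waveLen m t ^ (2 * l) : ℝ) : ℂ) * c m + ∑' r : Lat n, w (m - r) * c r = (μ : ℂ) * c m

/-- The closed spectral subspace of `H₀(t) + W` for the part of the spectrum at distance less than
`d = |v_q|/10` from the model eigenvalue `λ̂^±(t)` (the spectrum is discrete). -/
def spectralSubspace {n : ℕ} (l : ℕ) (v : Lat n →₀ ℂ) (q : Lat n) (s : ℤˣ) (j : Lat n)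
    (t : Rn n) (w : Lat n → ℂ) : Submodule ℂ (Ell2 n) :=
  (Submodule.span ℂ {c : Ell2 n | ∃ μ : ℝ, |μ - modelEigenvalue l v q s j t| < ‖v q‖ / 10 ∧
    IsEigenvector l t w μ c}).topologicalClosure

instance {n : ℕ} (l : ℕ) (v : Lat n →₀ ℂ) (q : Lat n) (s : ℤˣ) (j : Lat n)
    (t : Rn n) (w : Lat n → ℂ) : (spectralSubspace l v q s j t w).HasOrthogonalProjection := by
  unfold spectralSubspace
  infer_instance

/-- `μ` is an eigenvalue of `H₀(t) + W` at distance less than `d = |v_q|/10` from `λ̂^±(t)`. -/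
def IsNearEigenvalue {n : ℕ} (l : ℕ) (v : Lat n →₀ ℂ) (q : Lat n) (s : ℤˣ) (j : Lat n)
    (t : Rn n) (w : Lat n → ℂ) (μ : ℝ) : Prop :=
  |μ - modelEigenvalue l v q s j t| < ‖v q‖ / 10 ∧ ∃ c : Ell2 n, c ≠ 0 ∧ IsEigenvector l t w μ c

/-- The coefficients `m ↦ A (E_W(t))_{m j}` of `û_W` in the basis `exp(i⟨P_m(t), x⟩)`, where
`E_W(t)` is the spectral projection onto `spectralSubspace`. -/
def waveCoeff {n : ℕ} (l : ℕ) (v : Lat n →₀ ℂ) (q : Lat n) (s : ℤˣ) (j : Lat n)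
    (t : Rn n) (A : ℂ) (w : Lat n → ℂ) : Lat n → ℂ :=
  fun m => A * ((spectralSubspace l v q s j t w).starProjection (lp.single 2 j (1 : ℂ)) : Ell2 n) m

/-- The function `û_W(x) = A ∑_m (E_W(t))_{m j} exp(i⟨P_m(t), x⟩)`. -/
def waveFun {n : ℕ} (l : ℕ) (v : Lat n →₀ ℂ) (q : Lat n) (s : ℤˣ) (j : Lat n)
    (t : Rn n) (A : ℂ) (w : Lat n → ℂ) (x : Rn n) : ℂ :=
  ∑' m : Lat n, waveCoeff l v q s j t A w m *
    Complex.exp (Complex.I * ((⟪waveVec m t, x⟫_ℝ : ℝ) : ℂ))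

/-- The map `W ↦ V + σ |û_W|²` on periodic potentials, in terms of Fourier coefficients. -/
def potentialMap {n : ℕ} (l : ℕ) (v : Lat n →₀ ℂ) (q : Lat n) (s : ℤˣ) (j : Lat n)
    (t : Rn n) (σ : ℝ) (A : ℂ) (w : Lat n → ℂ) : Lat n → ℂ :=
  fun m => v m + (σ : ℂ) * ∑' r : Lat n,
    waveCoeff l v q s j t A w (m + r) * (starRingEnd ℂ) (waveCoeff l v q s j t A w r)

/-- The successive approximations `W₀ = V`, `W_{m+1} = V + σ |û_{W_m}|²`. -/
def potentialSeq {n : ℕ} (l : ℕ) (v : Lat n →₀ ℂ) (q : Lat n) (s : ℤˣ) (j : Lat n)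
    (t : Rn n) (σ : ℝ) (A : ℂ) : ℕ → Lat n → ℂ
  | 0 => fun m => v m
  | m + 1 => potentialMap l v q s j t σ A (potentialSeq l v q s j t σ A m)

/-- `w` is the limit of the sequence `W_m` in the norm `‖W‖_* = ∑_j |w_j|`. -/
def IsLimitPotential {n : ℕ} (l : ℕ) (v : Lat n →₀ ℂ) (q : Lat n) (s : ℤˣ) (j : Lat n)
    (t : Rn n) (σ : ℝ) (A : ℂ) (w : Lat n → ℂ) : Prop :=
  (∀ m, Summable fun i => ‖potentialSeq l v q s j t σ A m i‖) ∧
  (Summable fun i => ‖w i‖) ∧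
  Tendsto (fun m => ∑' i, ‖potentialSeq l v q s j t σ A m i - w i‖) atTop (𝓝 0)

/-- `u` is a classical solution of `(-Δ)^l u + V u + σ |u|² u = μ u` on `ℝⁿ` with the
quasiperiodicity conditions of quasimomentum `t` (which, being imposed at every point,
pass on to all the derivatives of `u`). -/
def IsQuasiperiodicSolution {n : ℕ} (l : ℕ) (v : Lat n →₀ ℂ) (σ : ℝ) (t : Rn n)
    (u : Rn n → ℂ) (μ : ℝ) : Prop :=
  ContDiff ℝ (2 * l : ℕ) u ∧
  (∀ (x : Rn n) (i : Fin n), u (x + EuclideanSpace.single i (2 * Real.pi)) =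
    Complex.exp (2 * Real.pi * Complex.I * (t i : ℂ)) * u x) ∧
  ∀ x : Rn n, ((fun f : Rn n → ℂ => -Laplacian.laplacian f)^[l] u) x +
    trigPoly v x * u x + (σ : ℂ) * ((‖u x‖ ^ 2 : ℝ) : ℂ) * u x = (μ : ℂ) * u x

/-- The part with label `j` of the surface `λ_W(t) = lam` of the nonlinear problem: the points `t`
of the neighborhood of the resonant set at which the eigenvalue `λ_W(t)` near `λ̂^±(t)`, for
the limit potential `W`, equals `lam`. -/
def nonlinearSurface {n : ℕ} (l : ℕ) (v : Lat n →₀ ℂ) (q : Lat n) (s : ℤˣ) (k δ σ : ℝ) (A : ℂ)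
    (j : Lat n) (lam : ℝ) : Set (Rn n) :=
  {t | t ∈ resonantNhd q k δ j ∧ ∃ w : Lat n → ℂ, IsLimitPotential l v q s j t σ A w ∧
    IsNearEigenvalue l v q s j t w lam}

/-- The part with label `j` of the model surface `λ̂^±(t) = lam`. -/
def modelSurface {n : ℕ} (l : ℕ) (v : Lat n →₀ ℂ) (q : Lat n) (s : ℤˣ) (j : Lat n)
    (lam : ℝ) : Set (Rn n) :=
  {t | modelEigenvalue l v q s j t = lam}

/-- The exponent `γ = min {γ₁, 2lγ₂}`, with `2γ₁ = 2l - n - 8δ`. -/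
def gammaExp (n l : ℕ) (δ γ₂ : ℝ) : ℝ :=
  min ((2 * (l : ℝ) - n - 8 * δ) / 2) (2 * l * γ₂)

end ResonantPolyharmonic

end

noncomputable section

namespace ResonantPolyharmonic

open scoped ENNReal InnerProductSpace ComplexConjugate
open Filter Topology

set_option linter.unusedSectionVars false

/-! Near the resonant set, every diagonal entry of the matrix other than those with labels `j` and
`j - q` differs from these two by at least a multiple of k^(2l-n-6δ), hence by any prescribed
constant once k is large (`eventually_gap`). So the operator is a 2×2 model matrix coupled, with a
strength fixed by V, to very remote levels. The analysis takes place in ℓ¹(ℤⁿ), where a potential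
acts by convolution with operator norm at most ‖W‖_*.

The model block is diagonalized and the eigenvector normalized as e + z, with e the model
eigenvector. Eliminating the eigenvalue shift leaves a quadratic fixed-point equation for z
(`correctionMap`). It is a contraction once `corrOp` and `corrFun` are small, and they are: with a
weight K on the remote sites, where K² is below the gap, the coupling in either direction is O(1/K)
(`norm_corrOp_le`, `norm_corrFun_le`). Conversely, any eigenvector whose eigenvalue lies in the
window produces a fixed point (`TwoLevel.exists_eq_smul_vec`), so the eigenvalue in the window is
unique and simple. The correction z is Lipschitz in W, and therefore so is the column of the
spectral projection; for small |σ||A|² the map W ↦ V + σ|û_W|² contracts a small ball around V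
(`exists_limit`). At its fixed point û_W is a self-consistent eigenfunction, and the eigenvalue
equation itself supplies the summability needed for 2l classical derivatives
(`isQuasiperiodicSolution_waveSeries`).

Part (b) only needs that λ_W lies within |v_q|/10 of the model eigenvalue. Along the direction of
P_j both entries of the model matrix grow at a rate of order k^(2l-1), so the model eigenvalue does
too. As γ ≤ l - 1/2, a displacement of order k^(-γ) changes it by more than a constant and must meet
the model surface (`exists_modelEigenvalue_eq`, `eventually_margin`). -/

/-- The Banach space `ℓ¹(ι)`. -/
abbrev Ell1 (ι : Type*) : Type _ := lp (fun _ : ι => ℂ) 1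

/-! ### Convolution, reflection and characters on ℓ¹. -/

namespace Ell1

variable {ι : Type*}

lemma summable_norm (f : Ell1 ι) : Summable fun i => ‖f i‖ := by
  simpa using (lp.memℓp f).summable (by simp)

lemma norm_eq (f : Ell1 ι) : ‖f‖ = ∑' i, ‖f i‖ := by
  simpa using lp.norm_eq_tsum_rpow (by simp) f

lemma norm_apply_le (f : Ell1 ι) (i : ι) : ‖f i‖ ≤ ‖f‖ := lp.norm_apply_le_norm (by simp) f i

/-- The element of `ℓ¹(ι)` given by an absolutely summable family. -/
def mk (f : ι → ℂ) (hf : Summable fun i => ‖f i‖) : Ell1 ι := ⟨f, memℓp_gen (by simpa using hf)⟩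

@[simp] lemma mk_apply (f : ι → ℂ) (hf : Summable fun i => ‖f i‖) (i : ι) : mk f hf i = f i := rfl

lemma norm_mk (f : ι → ℂ) (hf : Summable fun i => ‖f i‖) : ‖mk f hf‖ = ∑' i, ‖f i‖ := norm_eq _

lemma norm_le_of_le {f : Ell1 ι} {g : ι → ℝ} (hg : Summable g) (h : ∀ i, ‖f i‖ ≤ g i) :
    ‖f‖ ≤ ∑' i, g i := by
  rw [norm_eq]
  exact (summable_norm f).tsum_le_tsum h hg

/-- Multiplication by a bounded family. -/
def diag (d : ι → ℂ) (C : ℝ) (hd : ∀ i, ‖d i‖ ≤ C) : Ell1 ι →L[ℂ] Ell1 ι :=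
  LinearMap.mkContinuous
    { toFun := fun f => mk (fun i => d i * f i)
        (Summable.of_nonneg_of_le (fun _ => norm_nonneg _)
          (fun i => by rw [norm_mul]; exact mul_le_mul_of_nonneg_right (hd i) (norm_nonneg _))
          ((summable_norm f).mul_left C))
      map_add' := fun f g => by ext i; simp [mul_add]
      map_smul' := fun c f => by ext i; simp; ring } C
    (fun f => by
      refine (norm_le_of_le ((summable_norm f).mul_left C) fun i => ?_).trans_eq ?_
      · simp only [LinearMap.coe_mk, AddHom.coe_mk, mk_apply, norm_mul]
        exact mul_le_mul_of_nonneg_right (hd i) (norm_nonneg _)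
      · rw [tsum_mul_left, ← norm_eq])

@[simp] lemma diag_apply (d : ι → ℂ) (C : ℝ) (hd : ∀ i, ‖d i‖ ≤ C) (f : Ell1 ι) (i : ι) :
    diag d C hd f i = d i * f i := rfl

lemma norm_diag_le (d : ι → ℂ) (C : ℝ) (hC : 0 ≤ C) (hd : ∀ i, ‖d i‖ ≤ C) :
    ‖diag d C hd‖ ≤ C :=
  LinearMap.mkContinuous_norm_le _ hC _

/-- The pairing with a bounded family. -/
def pairing (χ : ι → ℂ) (hχ : ∀ i, ‖χ i‖ ≤ 1) : Ell1 ι →L[ℂ] ℂ :=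
  (lp.tsumCLM (𝕜 := ℂ) (α := ι) (E := ℂ)) ∘L diag χ 1 hχ

lemma pairing_apply (χ : ι → ℂ) (hχ : ∀ i, ‖χ i‖ ≤ 1) (f : Ell1 ι) :
    pairing χ hχ f = ∑' i, χ i * f i := rfl

/-- The coordinate functional. -/
abbrev coord (i : ι) : Ell1 ι →L[ℂ] ℂ := lp.evalCLM ℂ (fun _ : ι => ℂ) 1 i

lemma coord_apply (i : ι) (f : Ell1 ι) : coord i f = f i := rfl

lemma norm_coord_le (i : ι) : ‖(coord i : Ell1 ι →L[ℂ] ℂ)‖ ≤ 1 :=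
  ContinuousLinearMap.opNorm_le_bound _ zero_le_one fun f => by
    rw [one_mul]; exact norm_apply_le f i

lemma tsum_apply {κ : Type*} {F : κ → Ell1 ι} (hF : Summable F) (i : ι) :
    (∑' k, F k) i = ∑' k, F k i :=
  (coord i).map_tsum hF

section Group

variable [AddCommGroup ι]

lemma summable_norm_sub (f : Ell1 ι) (m : ι) : Summable fun i => ‖f (i - m)‖ :=
  (summable_norm f).comp_injective (Equiv.subRight m).injective

lemma summable_norm_neg (f : Ell1 ι) : Summable fun i => ‖conj (f (-i))‖ := by
  simp only [RCLike.norm_conj]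
  exact (summable_norm f).comp_injective neg_injective

/-- Translation of the index. -/
def shift (m : ι) : Ell1 ι →L[ℂ] Ell1 ι :=
  LinearMap.mkContinuous
    { toFun := fun f => mk (fun i => f (i - m)) (summable_norm_sub f m)
      map_add' := fun f g => by ext i; simp
      map_smul' := fun c f => by ext i; simp } 1
    (fun f => by
      simp only [LinearMap.coe_mk, AddHom.coe_mk, norm_mk, one_mul]
      rw [norm_eq]
      exact ((Equiv.subRight m).tsum_eq (fun i => ‖f i‖)).le)

@[simp] lemma shift_apply (m : ι) (f : Ell1 ι) (i : ι) : shift m f i = f (i - m) := rfl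

lemma norm_shift_le (m : ι) : ‖(shift m : Ell1 ι →L[ℂ] Ell1 ι)‖ ≤ 1 :=
  LinearMap.mkContinuous_norm_le _ zero_le_one _

lemma norm_smul_shift_le (w : Ell1 ι) (m : ι) : ‖w m • (shift m : Ell1 ι →L[ℂ] Ell1 ι)‖ ≤ ‖w m‖ := by
  rw [norm_smul]
  exact mul_le_of_le_one_right (norm_nonneg _) (norm_shift_le m)

lemma summable_smul_shift (w : Ell1 ι) :
    Summable fun m => w m • (shift m : Ell1 ι →L[ℂ] Ell1 ι) :=
  Summable.of_norm_bounded (summable_norm w) (norm_smul_shift_le w)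

/-- Convolution with `w`. -/
def conv (w : Ell1 ι) : Ell1 ι →L[ℂ] Ell1 ι := ∑' m, w m • shift m

lemma norm_conv_le (w : Ell1 ι) : ‖conv w‖ ≤ ‖w‖ := by
  rw [norm_eq]
  exact tsum_of_norm_bounded (summable_norm w).hasSum (norm_smul_shift_le w)

lemma conv_eq_tsum (w f : Ell1 ι) : conv w f = ∑' m, w m • shift m f := by
  have := (ContinuousLinearMap.apply ℂ (Ell1 ι) f).map_tsum (summable_smul_shift w)
  simpa [conv] using this

lemma summable_smul_shift_apply (w f : Ell1 ι) : Summable fun m => w m • shift m f := by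
  have := (ContinuousLinearMap.apply ℂ (Ell1 ι) f).summable (summable_smul_shift w)
  simpa using this

lemma conv_apply (w f : Ell1 ι) (i : ι) : conv w f i = ∑' r, w (i - r) * f r := by
  rw [conv_eq_tsum, tsum_apply (summable_smul_shift_apply w f),
    ← (Equiv.subLeft i).tsum_eq]
  simp

lemma conv_sub (w w' : Ell1 ι) : conv (w - w') = conv w - conv w' := by
  rw [conv, conv, conv, ← (summable_smul_shift w).tsum_sub (summable_smul_shift w')]
  simp [sub_smul]

/-- Three families are allowed instead of one character because the quasimomenta of the factors of a
product add up: periodic times t-quasiperiodic, or t times -t. -/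
lemma pairing_conv (χ χ₁ χ₂ : ι → ℂ) (hχ : ∀ i, ‖χ i‖ ≤ 1) (hχ₁ : ∀ i, ‖χ₁ i‖ ≤ 1)
    (hχ₂ : ∀ i, ‖χ₂ i‖ ≤ 1) (h : ∀ m i, χ (i + m) = χ₁ m * χ₂ i) (w f : Ell1 ι) :
    pairing χ hχ (conv w f) = pairing χ₁ hχ₁ w * pairing χ₂ hχ₂ f := by
  rw [conv_eq_tsum, (pairing χ hχ).map_tsum (summable_smul_shift_apply w f)]
  have key : ∀ m, pairing χ hχ (w m • shift m f) = χ₁ m * w m * pairing χ₂ hχ₂ f := by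
    intro m
    rw [map_smul, pairing_apply, pairing_apply, ← (Equiv.addRight m).tsum_eq, smul_eq_mul,
      ← tsum_mul_left, ← tsum_mul_left]
    refine tsum_congr fun i => ?_
    simp [h]
    ring
  simp_rw [key]
  rw [tsum_mul_right, pairing_apply χ₁ hχ₁]

/-- The conjugate reflection `f ↦ (i ↦ conj (f (-i)))`. -/
def reflect (f : Ell1 ι) : Ell1 ι :=
  mk (fun i => conj (f (-i))) (summable_norm_neg f)

@[simp] lemma reflect_apply (f : Ell1 ι) (i : ι) : reflect f i = conj (f (-i)) := rfl

lemma norm_reflect (f : Ell1 ι) : ‖reflect f‖ = ‖f‖ := by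
  rw [reflect, norm_mk, norm_eq]
  simpa using (Equiv.neg ι).tsum_eq (fun i => ‖f i‖)

lemma reflect_sub (f g : Ell1 ι) : reflect (f - g) = reflect f - reflect g := by
  ext i; simp

lemma conv_reflect_apply (f g : Ell1 ι) (m : ι) :
    conv f (reflect g) m = ∑' r, f (m + r) * conj (g r) := by
  rw [conv_apply, ← (Equiv.neg ι).tsum_eq]
  simp

/-- On the Fourier side this says that |u|² is real. It keeps all potentials of the iteration real,
and hence their eigenvalues. -/
lemma reflect_conv_reflect (f : Ell1 ι) : reflect (conv f (reflect f)) = conv f (reflect f) := by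
  ext m
  rw [reflect_apply, conv_reflect_apply, conv_reflect_apply, Complex.conj_tsum,
    ← (Equiv.addRight m).tsum_eq]
  refine tsum_congr fun i => ?_
  simp [add_comm, mul_comm]

lemma norm_conv_reflect_le (f g : Ell1 ι) : ‖conv f (reflect g)‖ ≤ ‖f‖ * ‖g‖ := by
  refine ((conv f).le_opNorm _).trans ?_
  rw [norm_reflect]
  exact mul_le_mul_of_nonneg_right (norm_conv_le f) (norm_nonneg _)

lemma norm_conv_reflect_sub_le (f g : Ell1 ι) :
    ‖conv f (reflect f) - conv g (reflect g)‖ ≤ (‖f‖ + ‖g‖) * ‖f - g‖ := by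
  have h : conv f (reflect f) - conv g (reflect g) =
      conv f (reflect (f - g)) + conv (f - g) (reflect g) := by
    rw [reflect_sub, conv_sub, map_sub, sub_apply]
    abel
  rw [h]
  refine (norm_add_le _ _).trans ((add_le_add (norm_conv_reflect_le _ _)
    (norm_conv_reflect_le _ _)).trans_eq (by ring))

end Group

end Ell1

/-! ### The quadratic fixed-point equation for the correction of an eigenvector. -/

lemma norm_add_le_two {X : Type*} [NormedAddCommGroup X] {e : X} (he : ‖e‖ ≤ 1) {z : X}
    (hz : ‖z‖ ≤ 1) : ‖e + z‖ ≤ 2 :=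
  (norm_add_le _ _).trans (by linarith)

section FixedPoint

variable {X : Type*} [NormedAddCommGroup X] [NormedSpace ℂ X]

/-- The quadratic map whose fixed points are the corrections to the approximate eigenvector `e`. -/
def correctionMap (T G : X →L[ℂ] X) (ψ : X →L[ℂ] ℂ) (e z : X) : X :=
  ψ (e + z) • T z - G (e + z)

variable {T G G' : X →L[ℂ] X} {ψ ψ' : X →L[ℂ] ℂ} {e : X} {τ ε : ℝ}

lemma norm_correctionMap_le (hT : ‖T‖ ≤ τ) (hG : ‖G‖ ≤ ε) (hψ : ‖ψ‖ ≤ ε) (he : ‖e‖ ≤ 1)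
    (hε : ε * (4 * τ + 3) ≤ 1 / 2) {z : X} (hz : ‖z‖ ≤ 1) : ‖correctionMap T G ψ e z‖ ≤ 1 := by
  have h2 := norm_add_le_two he hz
  have hτ : 0 ≤ τ := (norm_nonneg _).trans hT
  have hε0 : 0 ≤ ε := (norm_nonneg _).trans hG
  have h3 : ‖ψ (e + z)‖ ≤ ε * 2 := ψ.le_of_opNorm_le_of_le hψ h2
  have h4 : ‖G (e + z)‖ ≤ ε * 2 := G.le_of_opNorm_le_of_le hG h2
  have h5 : ‖T z‖ ≤ τ * 1 := T.le_of_opNorm_le_of_le hT hz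
  calc ‖correctionMap T G ψ e z‖ ≤ ‖ψ (e + z)‖ * ‖T z‖ + ‖G (e + z)‖ := by
        rw [← norm_smul]; exact norm_sub_le _ _
    _ ≤ ε * 2 * (τ * 1) + ε * 2 := by gcongr
    _ ≤ 1 := by nlinarith [mul_nonneg hε0 hτ]

lemma norm_correctionMap_sub_le (hT : ‖T‖ ≤ τ) (hG : ‖G‖ ≤ ε) (hψ : ‖ψ‖ ≤ ε) (he : ‖e‖ ≤ 1)
    (hε : ε * (4 * τ + 3) ≤ 1 / 2) {z z' : X} (hz : ‖z‖ ≤ 1) (hz' : ‖z'‖ ≤ 1) :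
    ‖correctionMap T G ψ e z - correctionMap T G ψ e z'‖ ≤ 1 / 2 * ‖z - z'‖ := by
  have h2 := norm_add_le_two he hz
  have hτ : 0 ≤ τ := (norm_nonneg _).trans hT
  have hε0 : 0 ≤ ε := (norm_nonneg _).trans hG
  have h3 : ‖ψ (e + z)‖ ≤ ε * 2 := ψ.le_of_opNorm_le_of_le hψ h2
  have h4 : ‖G (z - z')‖ ≤ ε * ‖z - z'‖ := G.le_of_opNorm_le hG _
  have h4' : ‖ψ (z - z')‖ ≤ ε * ‖z - z'‖ := ψ.le_of_opNorm_le hψ _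
  have h5 : ‖T z'‖ ≤ τ * 1 := T.le_of_opNorm_le_of_le hT hz'
  have h6 : ‖T (z - z')‖ ≤ τ * ‖z - z'‖ := T.le_of_opNorm_le hT _
  have h : correctionMap T G ψ e z - correctionMap T G ψ e z' =
      ψ (e + z) • T (z - z') + ψ (z - z') • T z' - G (z - z') := by
    simp only [correctionMap, map_add, map_sub]
    module
  rw [h]
  calc _ ≤ ‖ψ (e + z)‖ * ‖T (z - z')‖ + ‖ψ (z - z')‖ * ‖T z'‖ + ‖G (z - z')‖ := by
        rw [← norm_smul, ← norm_smul]
        exact (norm_sub_le _ _).trans (by gcongr; exact norm_add_le _ _)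
    _ ≤ ε * 2 * (τ * ‖z - z'‖) + ε * ‖z - z'‖ * (τ * 1) + ε * ‖z - z'‖ := by gcongr
    _ = (ε * (3 * τ + 1)) * ‖z - z'‖ := by ring
    _ ≤ 1 / 2 * ‖z - z'‖ := by
        gcongr
        nlinarith [mul_nonneg hε0 hτ]

lemma exists_correctionMap_eq [CompleteSpace X] (hT : ‖T‖ ≤ τ) (hG : ‖G‖ ≤ ε) (hψ : ‖ψ‖ ≤ ε)
    (he : ‖e‖ ≤ 1) (hε : ε * (4 * τ + 3) ≤ 1 / 2) :
    ∃ z : X, ‖z‖ ≤ 1 ∧ correctionMap T G ψ e z = z := by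
  have hmaps : Set.MapsTo (correctionMap T G ψ e) (Metric.closedBall 0 1)
      (Metric.closedBall 0 1) := by
    intro z hz
    rw [mem_closedBall_zero_iff] at hz ⊢
    exact norm_correctionMap_le hT hG hψ he hε hz
  have hc : ContractingWith (1 / 2) (hmaps.restrict _ _ _) := by
    refine ⟨by norm_num, LipschitzWith.of_dist_le_mul ?_⟩
    rintro ⟨x, hx⟩ ⟨y, hy⟩
    rw [mem_closedBall_zero_iff] at hx hy
    simpa [Subtype.dist_eq, dist_eq_norm] using
      norm_correctionMap_sub_le hT hG hψ he hε hx hy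
  obtain ⟨z, hz, hfix, -⟩ := hc.exists_fixedPoint' (x := 0) Metric.isClosed_closedBall.isComplete
    hmaps (by simp) (edist_ne_top _ _)
  exact ⟨z, by simpa using hz, hfix⟩

/-- Fixed points of a 1/2-contraction move by at most twice the change of the map at one point. Only
the unprimed data have to be small. -/
lemma norm_sub_le_of_correctionMap_eq (hT : ‖T‖ ≤ τ) (hG : ‖G‖ ≤ ε) (hψ : ‖ψ‖ ≤ ε)
    (he : ‖e‖ ≤ 1) (hε : ε * (4 * τ + 3) ≤ 1 / 2) {z z' : X} (hz : ‖z‖ ≤ 1) (hz' : ‖z'‖ ≤ 1)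
    (h : correctionMap T G ψ e z = z) (h' : correctionMap T G' ψ' e z' = z') :
    ‖z - z'‖ ≤ 4 * τ * ‖ψ - ψ'‖ + 4 * ‖G - G'‖ := by
  have h1 := norm_correctionMap_sub_le hT hG hψ he hε hz hz'
  have h2 := norm_add_le_two he hz'
  have hτ : 0 ≤ τ := (norm_nonneg _).trans hT
  have h3 : ‖(ψ - ψ') (e + z')‖ ≤ ‖ψ - ψ'‖ * 2 := (ψ - ψ').le_opNorm_of_le h2
  have h4 : ‖(G - G') (e + z')‖ ≤ ‖G - G'‖ * 2 := (G - G').le_opNorm_of_le h2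
  have h5 : ‖T z'‖ ≤ τ * 1 := T.le_of_opNorm_le_of_le hT hz'
  have h6 : correctionMap T G ψ e z' - correctionMap T G' ψ' e z' =
      (ψ - ψ') (e + z') • T z' - (G - G') (e + z') := by
    simp only [correctionMap, sub_apply]
    module
  have h7 : ‖correctionMap T G ψ e z' - correctionMap T G' ψ' e z'‖ ≤
      ‖ψ - ψ'‖ * 2 * (τ * 1) + ‖G - G'‖ * 2 := by
    rw [h6]
    refine (norm_sub_le _ _).trans ?_
    rw [norm_smul]
    gcongr
  have h8 : ‖z - z'‖ ≤ ‖correctionMap T G ψ e z - correctionMap T G ψ e z'‖ +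
      ‖correctionMap T G ψ e z' - correctionMap T G' ψ' e z'‖ := by
    nth_rewrite 1 [← h, ← h']
    exact norm_sub_le_norm_sub_add_norm_sub _ _ _
  linarith

end FixedPoint

/-! ### Operators acting on two distinguished coordinates. -/

namespace Ell1

variable {ι : Type*} [DecidableEq ι]

/-- The inclusion of the `i`-th coordinate line. -/
abbrev single (i : ι) : ℂ →L[ℂ] Ell1 ι := lp.singleContinuousLinearMap ℂ (fun _ : ι => ℂ) 1 i

lemma single_apply (i : ι) (x : ℂ) (k : ι) : single i x k = if k = i then x else 0 := by
  simp only [lp.singleContinuousLinearMap_apply, lp.single_apply, Pi.single_apply]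

lemma norm_single (i : ι) (x : ℂ) : ‖single i x‖ = ‖x‖ := by
  rw [lp.singleContinuousLinearMap_apply, lp.norm_single (by simp)]

lemma norm_single_le (i : ι) : ‖(single i : ℂ →L[ℂ] Ell1 ι)‖ ≤ 1 :=
  ContinuousLinearMap.opNorm_le_bound _ zero_le_one fun x => by rw [norm_single, one_mul]

/-- The projection onto the coordinates `i₀`, `i₁`. -/
def inner (i₀ i₁ : ι) : Ell1 ι →L[ℂ] Ell1 ι :=
  diag (fun i => if i = i₀ ∨ i = i₁ then 1 else 0) 1 (fun i => by split_ifs <;> simp)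

/-- The projection onto the coordinates other than `i₀`, `i₁`. -/
def outer (i₀ i₁ : ι) : Ell1 ι →L[ℂ] Ell1 ι :=
  diag (fun i => if i = i₀ ∨ i = i₁ then 0 else 1) 1 (fun i => by split_ifs <;> simp)

lemma inner_apply (i₀ i₁ : ι) (f : Ell1 ι) (i : ι) :
    inner i₀ i₁ f i = if i = i₀ ∨ i = i₁ then f i else 0 := by
  simp [inner]

lemma outer_apply (i₀ i₁ : ι) (f : Ell1 ι) (i : ι) :
    outer i₀ i₁ f i = if i = i₀ ∨ i = i₁ then 0 else f i := by
  simp [outer]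

lemma norm_inner_le (i₀ i₁ : ι) : ‖inner i₀ i₁‖ ≤ 1 := norm_diag_le _ _ zero_le_one _

lemma norm_outer_le (i₀ i₁ : ι) : ‖outer i₀ i₁‖ ≤ 1 := norm_diag_le _ _ zero_le_one _

/-- The operator acting by the matrix `!![α, β; γ, δ]` on the coordinates `i₀`, `i₁` and by the
identity on the others. -/
def block (i₀ i₁ : ι) (α β γ δ : ℂ) : Ell1 ι →L[ℂ] Ell1 ι :=
  outer i₀ i₁ + single i₀ ∘L (α • coord i₀ + β • coord i₁) +
    single i₁ ∘L (γ • coord i₀ + δ • coord i₁)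

lemma block_apply (i₀ i₁ : ι) (α β γ δ : ℂ) (f : Ell1 ι) (i : ι) :
    block i₀ i₁ α β γ δ f i = (if i = i₀ ∨ i = i₁ then 0 else f i) +
      (if i = i₀ then α * f i₀ + β * f i₁ else 0) +
      (if i = i₁ then γ * f i₀ + δ * f i₁ else 0) := by
  simp only [block, add_apply, ContinuousLinearMap.comp_apply, lp.coeFn_add,
    Pi.add_apply, outer_apply, single_apply, smul_apply,
    coord_apply, smul_eq_mul]

lemma block_apply_left {i₀ i₁ : ι} (h : i₁ ≠ i₀) (α β γ δ : ℂ) (f : Ell1 ι) :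
    block i₀ i₁ α β γ δ f i₀ = α * f i₀ + β * f i₁ := by
  simp [block_apply, h.symm]

lemma block_apply_right {i₀ i₁ : ι} (h : i₁ ≠ i₀) (α β γ δ : ℂ) (f : Ell1 ι) :
    block i₀ i₁ α β γ δ f i₁ = γ * f i₀ + δ * f i₁ := by
  simp [block_apply, h]

lemma block_apply_other {i₀ i₁ i : ι} (h₀ : i ≠ i₀) (h₁ : i ≠ i₁) (α β γ δ : ℂ) (f : Ell1 ι) :
    block i₀ i₁ α β γ δ f i = f i := by
  simp [block_apply, h₀, h₁]

lemma norm_block_le (i₀ i₁ : ι) {α β γ δ : ℂ} (hα : ‖α‖ ≤ 1) (hβ : ‖β‖ ≤ 1) (hγ : ‖γ‖ ≤ 1)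
    (hδ : ‖δ‖ ≤ 1) : ‖block i₀ i₁ α β γ δ‖ ≤ 5 := by
  have key : ∀ (i : ι) {x y : ℂ}, ‖x‖ ≤ 1 → ‖y‖ ≤ 1 →
      ‖single i ∘L (x • coord i₀ + y • coord i₁ : Ell1 ι →L[ℂ] ℂ)‖ ≤ 2 := by
    intro i x y hx hy
    refine (ContinuousLinearMap.opNorm_comp_le _ _).trans ?_
    have h1 : ‖(x • coord i₀ + y • coord i₁ : Ell1 ι →L[ℂ] ℂ)‖ ≤ 1 * 1 + 1 * 1 := by
      refine (norm_add_le _ _).trans ?_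
      rw [norm_smul, norm_smul]
      gcongr <;> exact norm_coord_le _
    calc _ ≤ 1 * (1 * 1 + 1 * 1 : ℝ) := by gcongr; exact norm_single_le _
      _ = 2 := by norm_num
  calc _ ≤ (1 + 2 + 2 : ℝ) :=
        (norm_add_le _ _).trans (add_le_add ((norm_add_le _ _).trans
          (add_le_add (norm_outer_le _ _) (key _ hα hβ))) (key _ hγ hδ))
    _ = 5 := by norm_num

end Ell1

/-! ### The two-level model: rotation, weights and reduced resolvent. -/

/-- A diagonal matrix `a` perturbed by the coupling `β` of the sites `i₀`, `i₁`: `(p, r)` is the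
unit eigenvector of the model matrix for the eigenvalue `lam`, and `lam'` is the other eigenvalue.
The remaining diagonal entries are at distance at least `K ^ 2` from `lam`. -/
structure TwoLevel (ι : Type*) where
  (i₀ i₁ : ι) (a : ι → ℝ) (β p r : ℂ) (lam lam' K : ℝ)
  ne : i₁ ≠ i₀
  unit : ‖p‖ ^ 2 + ‖r‖ ^ 2 = 1
  eig₀ : a i₀ * p + β * r = lam * p
  eig₁ : conj β * p + a i₁ * r = lam * r
  trace : lam + lam' = a i₀ + a i₁
  β_ne : β ≠ 0
  split : 2 * ‖β‖ ≤ |lam' - lam|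
  one_le_K : 1 ≤ K
  le_K : 2 * ‖β‖ ≤ K
  gap : ∀ i, i ≠ i₀ → i ≠ i₁ → K ^ 2 ≤ |a i - lam|

namespace TwoLevel

open Ell1

variable {ι : Type*} (D : TwoLevel ι)

lemma norm_p_le : ‖D.p‖ ≤ 1 := by
  have := D.unit
  nlinarith [norm_nonneg D.p, sq_nonneg ‖D.r‖]

lemma norm_r_le : ‖D.r‖ ≤ 1 := by
  have := D.unit
  nlinarith [norm_nonneg D.r, sq_nonneg ‖D.p‖]

lemma unit_complex : conj D.p * D.p + conj D.r * D.r = 1 := by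
  rw [← Complex.normSq_eq_conj_mul_self, ← Complex.normSq_eq_conj_mul_self,
    Complex.normSq_eq_norm_sq, Complex.normSq_eq_norm_sq]
  exact_mod_cast D.unit

lemma K_pos : 0 < D.K := lt_of_lt_of_le one_pos D.one_le_K

lemma β_pos : 0 < ‖D.β‖ := norm_pos_iff.2 D.β_ne

/-- The norm bound of the reduced resolvent. -/
def τ : ℝ := 1 / (2 * ‖D.β‖)

lemma τ_pos : 0 < D.τ := by have := D.β_pos; unfold τ; positivity

/-- This is what `le_K` is for: the remote sites then obey the same resolvent bound `τ` as the
second model level. -/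
lemma inv_K_le_τ : D.K⁻¹ ≤ D.τ := by
  have := D.β_pos
  rw [τ, one_div]
  exact inv_anti₀ (by positivity) D.le_K

variable [DecidableEq ι]

/-- The unitary that diagonalizes the model matrix. -/
def rot : Ell1 ι →L[ℂ] Ell1 ι := block D.i₀ D.i₁ D.p (-conj D.r) D.r (conj D.p)

/-- The inverse of `rot`. -/
def rotInv : Ell1 ι →L[ℂ] Ell1 ι := block D.i₀ D.i₁ (conj D.p) (conj D.r) (-D.r) D.p

lemma norm_rot_le : ‖D.rot‖ ≤ 5 :=
  norm_block_le _ _ D.norm_p_le (by simpa using D.norm_r_le) D.norm_r_le (by simpa using D.norm_p_le)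

lemma norm_rotInv_le : ‖D.rotInv‖ ≤ 5 :=
  norm_block_le _ _ (by simpa using D.norm_p_le) (by simpa using D.norm_r_le)
    (by simpa using D.norm_r_le) D.norm_p_le

lemma rot_rotInv (f : Ell1 ι) : D.rot (D.rotInv f) = f := by
  have hu := D.unit_complex
  ext i
  by_cases h₀ : i = D.i₀
  · subst h₀
    rw [rot, block_apply_left D.ne, rotInv, block_apply_left D.ne, block_apply_right D.ne]
    linear_combination (f D.i₀) * hu
  by_cases h₁ : i = D.i₁
  · subst h₁
    rw [rot, block_apply_right D.ne, rotInv, block_apply_left D.ne, block_apply_right D.ne]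
    linear_combination (f D.i₁) * hu
  · rw [rot, block_apply_other h₀ h₁, rotInv, block_apply_other h₀ h₁]

/-- The weights: `1` on the two sites and `x` elsewhere. -/
def weight (x : ℝ) (hx : 0 ≤ x) : Ell1 ι →L[ℂ] Ell1 ι :=
  diag (fun i => if i = D.i₀ ∨ i = D.i₁ then 1 else (x : ℂ)) (max 1 x) (fun i => by
    split_ifs <;> simp [abs_of_nonneg hx])

lemma norm_weight_le (x : ℝ) (hx : 0 ≤ x) : ‖D.weight x hx‖ ≤ max 1 x := by
  unfold weight
  exact norm_diag_le _ _ (by positivity) _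

lemma weight_apply_inner (x : ℝ) (hx : 0 ≤ x) (f : Ell1 ι) {i : ι} (h : i = D.i₀ ∨ i = D.i₁) :
    D.weight x hx f i = f i := by
  simp [weight, h]

lemma weight_apply_other (x : ℝ) (hx : 0 ≤ x) (f : Ell1 ι) {i : ι} (h₀ : i ≠ D.i₀)
    (h₁ : i ≠ D.i₁) : D.weight x hx f i = x * f i := by
  simp [weight, h₀, h₁]

/-- The scaling by `K⁻¹` off the two sites. -/
def scale : Ell1 ι →L[ℂ] Ell1 ι := D.weight D.K⁻¹ (inv_nonneg.2 D.K_pos.le)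

/-- The inverse of `scale`. -/
def scaleInv : Ell1 ι →L[ℂ] Ell1 ι := D.weight D.K D.K_pos.le

lemma norm_scale_le : ‖D.scale‖ ≤ 1 := by
  have h : max 1 D.K⁻¹ = 1 := max_eq_left (inv_le_one_of_one_le₀ D.one_le_K)
  exact (D.norm_weight_le _ _).trans h.le

lemma scale_scaleInv (f : Ell1 ι) : D.scale (D.scaleInv f) = f := by
  have hK : (D.K : ℂ) ≠ 0 := by exact_mod_cast D.K_pos.ne'
  ext i
  by_cases h : i = D.i₀ ∨ i = D.i₁
  · rw [scale, scaleInv, weight_apply_inner _ _ _ _ h, weight_apply_inner _ _ _ _ h]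
  · push Not at h
    rw [scale, scaleInv, weight_apply_other _ _ _ _ h.1 h.2, weight_apply_other _ _ _ _ h.1 h.2]
    push_cast
    field_simp

/-- The entries of the reduced resolvent of the diagonalized model. -/
def res (i : ι) : ℂ :=
  if i = D.i₀ then 0 else if i = D.i₁ then ((D.lam' - D.lam : ℝ) : ℂ)⁻¹
    else ((D.a i - D.lam : ℝ) : ℂ)⁻¹

lemma res_right : D.res D.i₁ = ((D.lam' - D.lam : ℝ) : ℂ)⁻¹ := by simp [res, D.ne]

lemma res_other {i : ι} (h₀ : i ≠ D.i₀) (h₁ : i ≠ D.i₁) :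
    D.res i = ((D.a i - D.lam : ℝ) : ℂ)⁻¹ := by simp [res, h₀, h₁]

lemma norm_res_other_le {i : ι} (h₀ : i ≠ D.i₀) (h₁ : i ≠ D.i₁) : ‖D.res i‖ ≤ (D.K ^ 2)⁻¹ := by
  rw [D.res_other h₀ h₁, norm_inv, Complex.norm_real, Real.norm_eq_abs]
  have := D.K_pos
  exact inv_anti₀ (by positivity) (D.gap i h₀ h₁)

lemma norm_res_right_le : ‖D.res D.i₁‖ ≤ D.τ := by
  rw [res_right, norm_inv, Complex.norm_real, Real.norm_eq_abs, τ, one_div]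
  have := D.β_pos
  exact inv_anti₀ (by positivity) D.split

/-- The gap is `K ^ 2` so that undoing the scaling, at the cost of a factor `K`, still leaves a gain
of `K⁻¹`. -/
lemma norm_K_mul_res_le (i : ι) (h₀ : i ≠ D.i₀) (h₁ : i ≠ D.i₁) :
    ‖(D.K : ℂ) * D.res i‖ ≤ D.K⁻¹ := by
  have hK := D.K_pos
  rw [norm_mul, Complex.norm_real, Real.norm_eq_abs, abs_of_pos hK]
  calc D.K * ‖D.res i‖ ≤ D.K * (D.K ^ 2)⁻¹ := by gcongr; exact D.norm_res_other_le h₀ h₁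
    _ = D.K⁻¹ := by field_simp

lemma norm_res_le (i : ι) : ‖D.res i‖ ≤ D.τ := by
  by_cases h₀ : i = D.i₀
  · simp [res, h₀, D.τ_pos.le]
  by_cases h₁ : i = D.i₁
  · rw [h₁]; exact D.norm_res_right_le
  · refine le_trans ?_ ((D.norm_K_mul_res_le i h₀ h₁).trans D.inv_K_le_τ)
    rw [norm_mul, Complex.norm_real, Real.norm_eq_abs, abs_of_pos D.K_pos]
    exact le_mul_of_one_le_left (norm_nonneg _) D.one_le_K

lemma norm_weighted_res_le (i : ι) :
    ‖(if i = D.i₀ ∨ i = D.i₁ then 1 else (D.K : ℂ)) * D.res i‖ ≤ D.τ := by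
  split_ifs with h
  · rw [one_mul]; exact D.norm_res_le i
  · push Not at h
    exact (D.norm_K_mul_res_le i h.1 h.2).trans D.inv_K_le_τ

/-- The reduced resolvent of the diagonalized model. -/
def resolvent : Ell1 ι →L[ℂ] Ell1 ι := diag D.res D.τ D.norm_res_le

/-- The weighted reduced resolvent. -/
def wresolvent : Ell1 ι →L[ℂ] Ell1 ι := diag _ D.τ D.norm_weighted_res_le

lemma norm_resolvent_le : ‖D.resolvent‖ ≤ D.τ := norm_diag_le _ _ D.τ_pos.le _

lemma norm_wresolvent_le : ‖D.wresolvent‖ ≤ D.τ := norm_diag_le _ _ D.τ_pos.le _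

lemma wresolvent_apply_inner (f : Ell1 ι) {i : ι} (h : i = D.i₀ ∨ i = D.i₁) :
    D.wresolvent f i = D.res i * f i := by
  simp [wresolvent, h]

lemma wresolvent_apply_other (f : Ell1 ι) {i : ι} (h₀ : i ≠ D.i₀) (h₁ : i ≠ D.i₁) :
    D.wresolvent f i = D.K * D.res i * f i := by
  simp [wresolvent, h₀, h₁]

lemma norm_outer_bound (i : ι) :
    ‖(if i = D.i₀ ∨ i = D.i₁ then 0 else (D.K : ℂ) * D.res i)‖ ≤ D.K⁻¹ := by
  split_ifs with h
  · simp [D.K_pos.le]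
  · push Not at h
    exact D.norm_K_mul_res_le i h.1 h.2

lemma norm_wresolvent_outer_le :
    ‖D.wresolvent ∘L D.rotInv ∘L outer D.i₀ D.i₁‖ ≤ D.K⁻¹ := by
  have h : D.wresolvent ∘L D.rotInv ∘L outer D.i₀ D.i₁ = diag _ D.K⁻¹ D.norm_outer_bound := by
    ext f i
    simp only [ContinuousLinearMap.comp_apply, diag_apply]
    by_cases h₀ : i = D.i₀
    · subst h₀
      rw [wresolvent_apply_inner _ _ (Or.inl rfl)]
      simp [res]
    by_cases h₁ : i = D.i₁
    · subst h₁
      rw [wresolvent_apply_inner _ _ (Or.inr rfl), rotInv, block_apply_right D.ne]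
      simp [outer_apply]
    · rw [wresolvent_apply_other _ _ h₀ h₁, rotInv, block_apply_other h₀ h₁]
      simp [outer_apply, h₀, h₁]
  rw [h]
  exact norm_diag_le _ _ (inv_nonneg.2 D.K_pos.le) _

/-- The rotation mixes the two sites only, so whatever the potential sends to the other sites does
not reach the eigenvalue correction. This removes from `corrFun` the one term that carries no small
factor. -/
lemma coord_rotInv_outer : coord D.i₀ ∘L D.rotInv ∘L outer D.i₀ D.i₁ = 0 := by
  ext f
  simp [coord_apply, rotInv, block_apply_left D.ne, outer_apply]

lemma norm_outer_rot_scale_le : ‖outer D.i₀ D.i₁ ∘L D.rot ∘L D.scale‖ ≤ D.K⁻¹ := by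
  have h0 : ∀ i, ‖(if i = D.i₀ ∨ i = D.i₁ then 0 else ((D.K⁻¹ : ℝ) : ℂ))‖ ≤ D.K⁻¹ := by
    intro i
    split_ifs with h
    · simp [D.K_pos.le]
    · simp [abs_of_pos D.K_pos]
  have h : outer D.i₀ D.i₁ ∘L D.rot ∘L D.scale = diag _ D.K⁻¹ h0 := by
    ext f i
    simp only [ContinuousLinearMap.comp_apply, diag_apply, outer_apply]
    split_ifs with h
    · simp
    · push Not at h
      rw [rot, block_apply_other h.1 h.2, scale, weight_apply_other _ _ _ _ h.1 h.2]
  rw [h]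
  exact norm_diag_le _ _ (inv_nonneg.2 D.K_pos.le) _

end TwoLevel

/-! ### The perturbation in rotated and weighted coordinates. -/

namespace TwoLevel

open Ell1

variable {ι : Type*} [DecidableEq ι] (D : TwoLevel ι)

lemma inner_add_outer (f : Ell1 ι) : inner D.i₀ D.i₁ f + outer D.i₀ D.i₁ f = f := by
  ext i
  simp only [lp.coeFn_add, Pi.add_apply, inner_apply, outer_apply]
  split_ifs <;> simp

variable [AddCommGroup ι]

/-- The coupling in the model matrix is the one given by the potential `v`. -/
structure IsCoupling (v : Ell1 ι) : Prop where
  zero : v 0 = 0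
  right : v (D.i₀ - D.i₁) = D.β
  left : v (D.i₁ - D.i₀) = conj D.β

/-- The part of the potential that is not in the model matrix. -/
def remainder (v w : Ell1 ι) : Ell1 ι →L[ℂ] Ell1 ι :=
  conv w - inner D.i₀ D.i₁ ∘L conv v ∘L inner D.i₀ D.i₁

lemma conv_inner_apply (v f : Ell1 ι) (i : ι) :
    conv v (inner D.i₀ D.i₁ f) i = v (i - D.i₀) * f D.i₀ + v (i - D.i₁) * f D.i₁ := by
  rw [conv_apply, tsum_eq_sum (s := {D.i₀, D.i₁})]
  · rw [Finset.sum_pair D.ne.symm]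
    simp [inner_apply]
  · intro b hb
    simp only [Finset.mem_insert, Finset.mem_singleton] at hb
    simp [inner_apply, hb]

variable {D} {v : Ell1 ι} (hv : D.IsCoupling v) (w f : Ell1 ι)

include hv in
lemma remainder_apply_left : D.remainder v w f D.i₀ = conv w f D.i₀ - D.β * f D.i₁ := by
  simp [remainder, inner_apply, conv_inner_apply, hv.zero, hv.right]

include hv in
lemma remainder_apply_right : D.remainder v w f D.i₁ = conv w f D.i₁ - conj D.β * f D.i₀ := by
  simp [remainder, inner_apply, conv_inner_apply, hv.zero, hv.left]

lemma remainder_apply_other {i : ι} (h₀ : i ≠ D.i₀) (h₁ : i ≠ D.i₁) :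
    D.remainder v w f i = conv w f i := by
  simp [remainder, inner_apply, h₀, h₁]

variable (D v)

/-- The model already contains the inner-to-inner part of `v`. In each term with `v` that is left, a
remote site occurs either as output or as input, and that is where a factor `K⁻¹` will come from. -/
lemma remainder_eq : D.remainder v w = conv (w - v) + outer D.i₀ D.i₁ ∘L conv v +
    inner D.i₀ D.i₁ ∘L conv v ∘L outer D.i₀ D.i₁ := by
  ext1 f
  have h1 := D.inner_add_outer (conv v f)
  have h2 := congrArg (inner D.i₀ D.i₁) (congrArg (conv v) (D.inner_add_outer f))
  simp only [map_add] at h2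
  simp only [remainder, conv_sub, sub_apply, add_apply, ContinuousLinearMap.comp_apply]
  rw [← h2] at h1
  generalize outer D.i₀ D.i₁ (conv v f) = y at h1 ⊢
  rw [← h1]
  abel

/-- The remainder in the rotated and weighted coordinates. -/
def rotated : Ell1 ι →L[ℂ] Ell1 ι := D.rotInv ∘L D.remainder v w ∘L D.rot ∘L D.scale

lemma rotated_sub (w' : Ell1 ι) :
    D.rotated v w - D.rotated v w' = D.rotInv ∘L conv (w - w') ∘L D.rot ∘L D.scale := by
  ext1 f
  simp [rotated, remainder, conv_sub]

lemma norm_rotInv_conv_le :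
    ‖D.rotInv ∘L conv w ∘L D.rot ∘L D.scale‖ ≤ 25 * ‖w‖ := by
  calc _ ≤ ‖D.rotInv‖ * (‖conv w‖ * (‖D.rot‖ * ‖D.scale‖)) :=
        (ContinuousLinearMap.opNorm_comp_le _ _).trans (by
          gcongr
          exact (ContinuousLinearMap.opNorm_comp_le _ _).trans (by
            gcongr
            exact ContinuousLinearMap.opNorm_comp_le _ _))
    _ ≤ 5 * (‖w‖ * (5 * 1)) := by
        gcongr
        · exact D.norm_rotInv_le
        · exact norm_conv_le w
        · exact D.norm_rot_le
        · exact D.norm_scale_le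
    _ = _ := by ring

lemma norm_rotInv_inner_le :
    ‖D.rotInv ∘L (inner D.i₀ D.i₁ ∘L conv v) ∘L (outer D.i₀ D.i₁ ∘L D.rot ∘L D.scale)‖ ≤
      5 * ‖v‖ * D.K⁻¹ := by
  calc _ ≤ ‖D.rotInv‖ * ((‖inner D.i₀ D.i₁‖ * ‖conv v‖) *
        ‖outer D.i₀ D.i₁ ∘L D.rot ∘L D.scale‖) :=
        (ContinuousLinearMap.opNorm_comp_le _ _).trans (by
          gcongr
          exact (ContinuousLinearMap.opNorm_comp_le _ _).trans (by
            gcongr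
            exact ContinuousLinearMap.opNorm_comp_le _ _))
    _ ≤ 5 * ((1 * ‖v‖) * D.K⁻¹) := by
        gcongr
        · exact D.norm_rotInv_le
        · exact norm_inner_le _ _
        · exact norm_conv_le v
        · exact D.norm_outer_rot_scale_le
    _ = _ := by ring

lemma rotated_eq : D.rotated v w = D.rotInv ∘L conv (w - v) ∘L D.rot ∘L D.scale +
    D.rotInv ∘L outer D.i₀ D.i₁ ∘L conv v ∘L D.rot ∘L D.scale +
    D.rotInv ∘L (inner D.i₀ D.i₁ ∘L conv v) ∘L (outer D.i₀ D.i₁ ∘L D.rot ∘L D.scale) := by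
  rw [rotated, remainder_eq]
  ext1 f
  simp

/-- The first order correction operator. -/
def corrOp : Ell1 ι →L[ℂ] Ell1 ι := D.wresolvent ∘L D.rotated v w

/-- The functional giving the correction of the eigenvalue. -/
def corrFun : Ell1 ι →L[ℂ] ℂ := coord D.i₀ ∘L D.rotated v w

/-- The common bound of `corrOp` and `corrFun` for potentials at distance at most `ρ` from `v`. -/
def smallness (ρ : ℝ) : ℝ := (1 + D.τ) * (25 * ρ + 5 * ‖v‖ * D.K⁻¹)

variable {v w} in
-- The three terms are small for three reasons: `w` is close to `v`; the weighted resolvent is at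
-- most `K⁻¹` on remote outputs; the scaling damps remote inputs. Without the weights the last term
-- would fail, since the resolvent at `i₁` is bounded by `τ` only.
lemma norm_corrOp_le {ρ : ℝ} (hw : ‖w - v‖ ≤ ρ) : ‖D.corrOp v w‖ ≤ D.smallness v ρ := by
  have hτ := D.τ_pos
  have hK := D.K_pos
  have hρ : 0 ≤ ρ := (norm_nonneg _).trans hw
  have h : D.corrOp v w = D.wresolvent ∘L (D.rotInv ∘L conv (w - v) ∘L D.rot ∘L D.scale) +
      (D.wresolvent ∘L D.rotInv ∘L outer D.i₀ D.i₁) ∘L conv v ∘L D.rot ∘L D.scale +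
      D.wresolvent ∘L (D.rotInv ∘L (inner D.i₀ D.i₁ ∘L conv v) ∘L
        (outer D.i₀ D.i₁ ∘L D.rot ∘L D.scale)) := by
    rw [corrOp, rotated_eq]
    ext1 f
    simp
  have h1 : ‖D.wresolvent ∘L (D.rotInv ∘L conv (w - v) ∘L D.rot ∘L D.scale)‖ ≤
      D.τ * (25 * ρ) :=
    (ContinuousLinearMap.opNorm_comp_le _ _).trans (mul_le_mul D.norm_wresolvent_le
      ((D.norm_rotInv_conv_le _).trans (by gcongr)) (norm_nonneg _) hτ.le)
  have h2 : ‖(D.wresolvent ∘L D.rotInv ∘L outer D.i₀ D.i₁) ∘L conv v ∘L D.rot ∘L D.scale‖ ≤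
      D.K⁻¹ * (‖v‖ * (5 * 1)) :=
    (ContinuousLinearMap.opNorm_comp_le _ _).trans (mul_le_mul D.norm_wresolvent_outer_le
      ((ContinuousLinearMap.opNorm_comp_le _ _).trans (mul_le_mul (norm_conv_le v)
        ((ContinuousLinearMap.opNorm_comp_le _ _).trans (mul_le_mul D.norm_rot_le
          D.norm_scale_le (norm_nonneg _) (by norm_num))) (norm_nonneg _) (norm_nonneg _)))
      (norm_nonneg _) (by positivity))
  have h3 : ‖D.wresolvent ∘L (D.rotInv ∘L (inner D.i₀ D.i₁ ∘L conv v) ∘L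
        (outer D.i₀ D.i₁ ∘L D.rot ∘L D.scale))‖ ≤ D.τ * (5 * ‖v‖ * D.K⁻¹) :=
    (ContinuousLinearMap.opNorm_comp_le _ _).trans (mul_le_mul D.norm_wresolvent_le
      (D.norm_rotInv_inner_le v) (norm_nonneg _) hτ.le)
  rw [h]
  refine (norm_add_le _ _).trans ((add_le_add_left (norm_add_le _ _) _).trans ?_)
  refine (add_le_add (add_le_add h1 h2) h3).trans ?_
  rw [smallness]
  nlinarith [mul_nonneg hτ.le hρ]

variable {v w} in
lemma norm_corrFun_le {ρ : ℝ} (hw : ‖w - v‖ ≤ ρ) : ‖D.corrFun v w‖ ≤ D.smallness v ρ := by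
  have hτ := D.τ_pos
  have hK := D.K_pos
  have hρ : 0 ≤ ρ := (norm_nonneg _).trans hw
  have h : D.corrFun v w = coord D.i₀ ∘L (D.rotInv ∘L conv (w - v) ∘L D.rot ∘L D.scale +
      D.rotInv ∘L (inner D.i₀ D.i₁ ∘L conv v) ∘L (outer D.i₀ D.i₁ ∘L D.rot ∘L D.scale)) := by
    have h0 := D.coord_rotInv_outer
    rw [corrFun, rotated_eq]
    ext1 f
    have h1 := congrArg (fun L : Ell1 ι →L[ℂ] ℂ => L (conv v (D.rot (D.scale f)))) h0
    simp only [ContinuousLinearMap.comp_apply, zero_apply] at h1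
    simp only [ContinuousLinearMap.comp_apply, add_apply, map_add, h1, add_zero]
  rw [h]
  refine (ContinuousLinearMap.opNorm_comp_le _ _).trans ?_
  calc _ ≤ 1 * (25 * ρ + 5 * ‖v‖ * D.K⁻¹) := by
        gcongr
        · exact norm_coord_le _
        · exact (norm_add_le _ _).trans (add_le_add ((D.norm_rotInv_conv_le _).trans (by gcongr))
            (D.norm_rotInv_inner_le v))
    _ ≤ _ := by
        rw [smallness]
        gcongr
        linarith

lemma norm_corrFun_sub_le (w' : Ell1 ι) :
    ‖D.corrFun v w - D.corrFun v w'‖ ≤ 25 * ‖w - w'‖ := by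
  have h : D.corrFun v w - D.corrFun v w' = coord D.i₀ ∘L (D.rotated v w - D.rotated v w') := by
    ext1 f; simp [corrFun]
  rw [h, rotated_sub]
  calc _ ≤ 1 * (25 * ‖w - w'‖) :=
        (ContinuousLinearMap.opNorm_comp_le _ _).trans (mul_le_mul (norm_coord_le _)
          (D.norm_rotInv_conv_le _) (norm_nonneg _) zero_le_one)
    _ = _ := one_mul _

lemma norm_corrOp_sub_le (w' : Ell1 ι) :
    ‖D.corrOp v w - D.corrOp v w'‖ ≤ D.τ * (25 * ‖w - w'‖) := by
  have h : D.corrOp v w - D.corrOp v w' = D.wresolvent ∘L (D.rotated v w - D.rotated v w') := by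
    ext1 f; simp [corrOp]
  rw [h, rotated_sub]
  exact (ContinuousLinearMap.opNorm_comp_le _ _).trans (mul_le_mul D.norm_wresolvent_le
          (D.norm_rotInv_conv_le _) (norm_nonneg _) D.τ_pos.le)

/-- `x` solves the eigenvalue equation in the rotated and weighted coordinates. -/
def IsRotatedEigenvector (η : ℂ) (x : Ell1 ι) : Prop :=
  η * x D.i₀ = D.corrFun v w x ∧
    x - x D.i₀ • single D.i₀ 1 = η • D.resolvent x - D.corrOp v w x

/-- `c` solves the eigenvalue equation for the eigenvalue `D.lam + η`. -/
def IsEigen (η : ℂ) (c : Ell1 ι) : Prop :=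
  ∀ i, (D.a i : ℂ) * c i + conv w c i = (D.lam + η) * c i

variable {v}

/-- The pair of equations is multiplied by the adjoint of the unitary with columns `(p, r)` and
`(-conj r, conj p)`, or by the unitary itself for the converse. The trace identity makes `lam'` the
second diagonal entry. -/
lemma model_iff (η x₀ x₁ b₀ b₁ : ℂ) :
    (D.a D.i₀ * (D.p * x₀ - conj D.r * x₁) + (b₀ + D.β * (D.r * x₀ + conj D.p * x₁)) =
        (D.lam + η) * (D.p * x₀ - conj D.r * x₁) ∧
      D.a D.i₁ * (D.r * x₀ + conj D.p * x₁) + (b₁ + conj D.β * (D.p * x₀ - conj D.r * x₁)) =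
        (D.lam + η) * (D.r * x₀ + conj D.p * x₁)) ↔
    (η * x₀ = conj D.p * b₀ + conj D.r * b₁ ∧
      (D.lam' - D.lam) * x₁ = η * x₁ - (-D.r * b₀ + D.p * b₁)) := by
  have hu := D.unit_complex
  have e₀ := D.eig₀
  have e₁ := D.eig₁
  have f₀ := congrArg conj D.eig₀
  have f₁ := congrArg conj D.eig₁
  have ht : (D.lam : ℂ) + D.lam' = D.a D.i₀ + D.a D.i₁ := by exact_mod_cast D.trace
  simp only [map_add, map_mul, Complex.conj_ofReal, Complex.conj_conj] at f₀ f₁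
  constructor
  · rintro ⟨h₀, h₁⟩
    constructor
    · linear_combination (-conj D.p) * h₀ - conj D.r * h₁ +
        (D.p * x₀ - conj D.r * x₁) * f₀ + (D.r * x₀ + conj D.p * x₁) * f₁ - η * x₀ * hu
    · linear_combination (-D.r) * h₀ + D.p * h₁ - (D.p * x₀ - conj D.r * x₁) * e₁ +
        (D.r * x₀ + conj D.p * x₁) * e₀ + ((D.p * x₀ - conj D.r * x₁) * (-D.r) +
        (D.r * x₀ + conj D.p * x₁) * D.p) * ht - ((D.lam' - D.lam) * x₁ - η * x₁) * hu
  · rintro ⟨h₀, h₁⟩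
    constructor
    · linear_combination (-D.p) * h₀ - conj D.r * h₁ + x₀ * e₀ + x₁ * f₁ +
        x₁ * conj D.r * ht - b₀ * hu
    · linear_combination (-D.r) * h₀ + conj D.p * h₁ + x₀ * e₁ - x₁ * f₀ -
        x₁ * conj D.p * ht - b₁ * hu

include hv in
-- The `i₀` component determines `η`; the other components are divided by `lam' - lam` or `a i -
-- lam`, nonzero by `split` and `gap`, so no solution is gained or lost.
lemma isEigen_iff (η : ℂ) (x : Ell1 ι) :
    D.IsEigen w η (D.rot (D.scale x)) ↔ D.IsRotatedEigenvector v w η x := by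
  set c := D.rot (D.scale x) with hc
  set b := D.remainder v w c with hb
  have hK : (D.K : ℂ) ≠ 0 := by exact_mod_cast D.K_pos.ne'
  have hx₀ : D.scale x D.i₀ = x D.i₀ := weight_apply_inner _ _ _ _ (Or.inl rfl)
  have hx₁ : D.scale x D.i₁ = x D.i₁ := weight_apply_inner _ _ _ _ (Or.inr rfl)
  have hc₀ : c D.i₀ = D.p * x D.i₀ - conj D.r * x D.i₁ := by
    rw [hc, rot, block_apply_left D.ne, hx₀, hx₁]; ring
  have hc₁ : c D.i₁ = D.r * x D.i₀ + conj D.p * x D.i₁ := by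
    rw [hc, rot, block_apply_right D.ne, hx₀, hx₁]
  have hci : ∀ i, i ≠ D.i₀ → i ≠ D.i₁ → x i = D.K * c i := by
    intro i h₀ h₁
    rw [hc, rot, block_apply_other h₀ h₁, scale, weight_apply_other _ _ _ _ h₀ h₁]
    push_cast
    field_simp
  have hw₀ : conv w c D.i₀ = b D.i₀ + D.β * c D.i₁ := by
    rw [hb, remainder_apply_left hv]; ring
  have hw₁ : conv w c D.i₁ = b D.i₁ + conj D.β * c D.i₀ := by
    rw [hb, remainder_apply_right hv]; ring
  have hwi : ∀ i, i ≠ D.i₀ → i ≠ D.i₁ → conv w c i = b i := fun i h₀ h₁ =>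
    (remainder_apply_other w c h₀ h₁).symm
  have hrot : D.rotated v w x = D.rotInv b := rfl
  have hfun : D.corrFun v w x = conj D.p * b D.i₀ + conj D.r * b D.i₁ := by
    rw [corrFun, ContinuousLinearMap.comp_apply, hrot, coord_apply, rotInv, block_apply_left D.ne]
  have hop₁ : D.corrOp v w x D.i₁ = D.res D.i₁ * (-D.r * b D.i₀ + D.p * b D.i₁) := by
    rw [corrOp, ContinuousLinearMap.comp_apply, hrot, wresolvent_apply_inner _ _ (Or.inr rfl),
      rotInv, block_apply_right D.ne]
  have hop₀ : D.corrOp v w x D.i₀ = 0 := by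
    rw [corrOp, ContinuousLinearMap.comp_apply, hrot, wresolvent_apply_inner _ _ (Or.inl rfl), res,
      if_pos rfl, zero_mul]
  have hopi : ∀ i, i ≠ D.i₀ → i ≠ D.i₁ → D.corrOp v w x i = D.K * D.res i * b i := by
    intro i h₀ h₁
    rw [corrOp, ContinuousLinearMap.comp_apply, hrot, wresolvent_apply_other _ _ h₀ h₁, rotInv,
      block_apply_other h₀ h₁]
  have hne₁ : ((D.lam' - D.lam : ℝ) : ℂ) ≠ 0 := by
    have h1 := D.split
    have h2 := D.β_pos
    have h3 : 0 < |D.lam' - D.lam| := by linarith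
    exact_mod_cast abs_pos.1 h3
  have hnei : ∀ i, i ≠ D.i₀ → i ≠ D.i₁ → ((D.a i - D.lam : ℝ) : ℂ) ≠ 0 := by
    intro i h₀ h₁
    have h1 := D.gap i h₀ h₁
    have h2 := D.K_pos
    have h3 : 0 < |D.a i - D.lam| := lt_of_lt_of_le (by positivity) h1
    exact_mod_cast abs_pos.1 h3
  have hmodel := D.model_iff η (x D.i₀) (x D.i₁) (b D.i₀) (b D.i₁)
  rw [← hc₀, ← hc₁, ← hw₀, ← hw₁, ← hfun] at hmodel
  have hcomp : x - x D.i₀ • single D.i₀ 1 = η • D.resolvent x - D.corrOp v w x ↔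
      ∀ i, x i - (if i = D.i₀ then x D.i₀ else 0) = η * (D.res i * x i) - D.corrOp v w x i := by
    rw [lp.ext_iff, funext_iff]
    refine forall_congr' fun i => ?_
    simp only [lp.coeFn_sub, Pi.sub_apply, lp.coeFn_smul, Pi.smul_apply, single_apply, smul_eq_mul,
      resolvent, diag_apply, mul_ite, mul_one, mul_zero]
  have hright : x D.i₁ - 0 = η * (D.res D.i₁ * x D.i₁) - D.corrOp v w x D.i₁ ↔
      ((D.lam' : ℂ) - D.lam) * x D.i₁ = η * x D.i₁ - (-D.r * b D.i₀ + D.p * b D.i₁) := by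
    rw [hop₁, res_right]
    push_cast at hne₁ ⊢
    constructor
    · intro h
      field_simp at h
      linear_combination h
    · intro h
      field_simp
      linear_combination h
  have hother : ∀ i, i ≠ D.i₀ → i ≠ D.i₁ →
      (x i - 0 = η * (D.res i * x i) - D.corrOp v w x i ↔
        (D.a i : ℂ) * c i + conv w c i = (D.lam + η) * c i) := by
    intro i h₀ h₁
    have hn := hnei i h₀ h₁
    rw [hopi i h₀ h₁, D.res_other h₀ h₁, hci i h₀ h₁, hwi i h₀ h₁]
    push_cast at hn ⊢
    constructor
    · intro h
      apply mul_left_cancel₀ hK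
      field_simp at h
      linear_combination h
    · intro h
      field_simp
      linear_combination D.K * h
  rw [IsRotatedEigenvector, hcomp]
  constructor
  · intro h
    obtain ⟨h0, h1⟩ := hmodel.1 ⟨h D.i₀, h D.i₁⟩
    refine ⟨h0, fun i => ?_⟩
    by_cases h₀ : i = D.i₀
    · subst h₀
      simp [hop₀, res]
    rw [if_neg h₀]
    by_cases h₁ : i = D.i₁
    · subst h₁
      exact hright.2 h1
    · exact (hother i h₀ h₁).2 (h i)
  · rintro ⟨h0, h⟩ i
    have h1 := h D.i₁
    rw [if_neg D.ne] at h1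
    obtain ⟨g₀, g₁⟩ := hmodel.2 ⟨h0, hright.1 h1⟩
    by_cases h₀ : i = D.i₀
    · subst h₀
      exact g₀
    by_cases h₁ : i = D.i₁
    · subst h₁
      exact g₁
    · have := h i
      rw [if_neg h₀] at this
      exact (hother i h₀ h₁).1 this

end TwoLevel

/-! ### The sesquilinear pairing and the symmetry of real potentials. -/

namespace Ell1

variable {ι : Type*}

/-- The functional `f ↦ ∑ i, conj (c i) * f i`. -/
def dual (c : Ell1 ι) : Ell1 ι →L[ℂ] ℂ :=
  (lp.tsumCLM (𝕜 := ℂ) (α := ι) (E := ℂ)) ∘L diag (fun i => conj (c i)) ‖c‖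
    (fun i => by rw [RCLike.norm_conj]; exact norm_apply_le c i)

lemma dual_apply (c f : Ell1 ι) : dual c f = ∑' i, conj (c i) * f i := rfl

lemma dual_self (c : Ell1 ι) : dual c c = ((∑' i, ‖c i‖ ^ 2 : ℝ) : ℂ) := by
  rw [dual_apply, Complex.ofReal_tsum]
  refine tsum_congr fun i => ?_
  rw [Complex.conj_mul']
  push_cast
  rfl

lemma summable_norm_sq (c : Ell1 ι) : Summable fun i => ‖c i‖ ^ 2 := by
  refine Summable.of_nonneg_of_le (fun i => sq_nonneg _) (fun i => ?_)
    ((summable_norm c).mul_left ‖c‖)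
  rw [sq]
  exact mul_le_mul_of_nonneg_right (norm_apply_le c i) (norm_nonneg _)

/-- The adjoint of the shift by `m` is the shift by `-m`, and for a real potential the coefficients
at `m` and `-m` are conjugate. -/
lemma conj_dual_conv [AddCommGroup ι] {w : Ell1 ι} (hw : reflect w = w) (c : Ell1 ι) :
    conj (dual c (conv w c)) = dual c (conv w c) := by
  have hA : ∀ m, conj (dual c (shift m c)) = dual c (shift (-m) c) := by
    intro m
    rw [dual_apply, dual_apply, Complex.conj_tsum, ← (Equiv.addRight m).tsum_eq]
    refine tsum_congr fun i => ?_
    simp [mul_comm]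
  have h : dual c (conv w c) = ∑' m, w m * dual c (shift m c) := by
    rw [conv_eq_tsum, (dual c).map_tsum (summable_smul_shift_apply w c)]
    simp
  rw [h, Complex.conj_tsum, ← (Equiv.neg ι).tsum_eq]
  refine tsum_congr fun m => ?_
  have h2 : conj (w (-m)) = w m := by rw [← reflect_apply, hw]
  simp [hA, h2]

end Ell1

/-! ### Existence, uniqueness and reality of the perturbed eigenvalue. -/

namespace TwoLevel

open Ell1

variable {ι : Type*} [DecidableEq ι] [AddCommGroup ι] (D : TwoLevel ι) (v w : Ell1 ι)

/-- `z` is the correction to the model eigenvector for the potential `w`. -/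
structure IsCorrection (z : Ell1 ι) : Prop where
  norm_le : ‖z‖ ≤ 1
  fixed : correctionMap D.resolvent (D.corrOp v w) (D.corrFun v w) (single D.i₀ 1) z = z

/-- The eigenvector obtained from the correction `z`. -/
def vec (z : Ell1 ι) : Ell1 ι := D.rot (D.scale (single D.i₀ 1 + z))

/-- The shift of the eigenvalue obtained from the correction `z`. -/
def eigShift (z : Ell1 ι) : ℂ := D.corrFun v w (single D.i₀ 1 + z)

/-- The smallness condition on the radius `ρ` of the ball of potentials around `v`. -/
structure IsSmall (ρ : ℝ) : Prop where
  contraction : D.smallness v ρ * (4 * D.τ + 3) ≤ 1 / 2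
  window : 20 * D.smallness v ρ < ‖D.β‖

variable {D v w} {ρ : ℝ} (hρ : D.IsSmall v ρ) (hw : ‖w - v‖ ≤ ρ)

lemma resolvent_apply_zero (f : Ell1 ι) : D.resolvent f D.i₀ = 0 := by simp [resolvent, res]

lemma corrOp_apply_zero (f : Ell1 ι) : D.corrOp v w f D.i₀ = 0 := by
  rw [corrOp, ContinuousLinearMap.comp_apply, wresolvent_apply_inner _ _ (Or.inl rfl), res,
    if_pos rfl, zero_mul]

lemma norm_single_one (i : ι) : ‖(single i 1 : Ell1 ι)‖ ≤ 1 := by rw [norm_single]; simp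

namespace IsCorrection

lemma apply_zero {z : Ell1 ι} (hz : D.IsCorrection v w z) : z D.i₀ = 0 := by
  rw [← hz.fixed, correctionMap, lp.coeFn_sub, Pi.sub_apply, corrOp_apply_zero, lp.coeFn_smul,
    Pi.smul_apply, resolvent_apply_zero, smul_zero, sub_zero]

lemma single_add_apply {z : Ell1 ι} (hz : D.IsCorrection v w z) :
    (single D.i₀ 1 + z : Ell1 ι) D.i₀ = 1 := by
  rw [lp.coeFn_add, Pi.add_apply, hz.apply_zero, single_apply]; simp

lemma resolvent_single : D.resolvent (single D.i₀ 1) = 0 := by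
  ext i
  by_cases h : i = D.i₀ <;> simp [resolvent, res, h]

lemma isEigen {z : Ell1 ι} (hv : D.IsCoupling v) (hz : D.IsCorrection v w z) :
    D.IsEigen w (D.eigShift v w z) (D.vec z) := by
  rw [vec, isEigen_iff D hv]
  refine ⟨?_, ?_⟩
  · rw [hz.single_add_apply, mul_one, eigShift]
  · rw [hz.single_add_apply, one_smul, add_sub_cancel_left, map_add, resolvent_single, zero_add]
    exact hz.fixed.symm

include hρ hw in
lemma norm_eigShift_lt {z : Ell1 ι} (hz : D.IsCorrection v w z) :
    ‖D.eigShift v w z‖ < ‖D.β‖ / 10 := by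
  have h1 : ‖D.eigShift v w z‖ ≤ D.smallness v ρ * 2 :=
    (D.corrFun v w).le_of_opNorm_le_of_le (D.norm_corrFun_le hw)
      (norm_add_le_two (norm_single_one _) hz.norm_le)
  linarith [hρ.window]

include hρ hw in
-- The constant is 4τ·25 from `corrFun` plus 4·25τ from `corrOp`. With `w' = w` the estimate gives
-- uniqueness of the correction.
lemma norm_sub_le {w' z z' : Ell1 ι} (hz : D.IsCorrection v w z) (hz' : D.IsCorrection v w' z') :
    ‖z - z'‖ ≤ 200 * D.τ * ‖w - w'‖ := by
  have h := norm_sub_le_of_correctionMap_eq D.norm_resolvent_le (D.norm_corrOp_le hw)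
    (D.norm_corrFun_le hw) (norm_single_one _) hρ.contraction hz.norm_le hz'.norm_le hz.fixed
    hz'.fixed
  have h1 := D.norm_corrFun_sub_le v w w'
  have h2 := D.norm_corrOp_sub_le v w w'
  have hτ := D.τ_pos
  calc _ ≤ _ := h
    _ ≤ 4 * D.τ * (25 * ‖w - w'‖) + 4 * (D.τ * (25 * ‖w - w'‖)) := by gcongr
    _ = _ := by ring

include hρ hw in
lemma unique {z z' : Ell1 ι} (hz : D.IsCorrection v w z) (hz' : D.IsCorrection v w z') :
    z = z' := by
  have := norm_sub_le hρ hw hz hz'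
  simpa [sub_eq_zero] using this

lemma norm_vec_le {z : Ell1 ι} (hz : D.IsCorrection v w z) : ‖D.vec z‖ ≤ 10 := by
  have h : ‖D.vec z‖ ≤ 5 * (1 * 2) :=
    D.rot.le_of_opNorm_le_of_le D.norm_rot_le (D.scale.le_of_opNorm_le_of_le D.norm_scale_le
      (norm_add_le_two (norm_single_one _) hz.norm_le))
  linarith

/-- The component of the vector along the model eigenvector `(p, r)` is exactly 1, because `z`
vanishes at `i₀`. Hence the moduli at the two sites add up to at least 1. -/
lemma half_le {z : Ell1 ι} (hz : D.IsCorrection v w z) : 1 / 2 ≤ ∑' i, ‖D.vec z i‖ ^ 2 := by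
  have h0 : D.scale (single D.i₀ 1 + z) D.i₀ = 1 := by
    rw [scale, weight_apply_inner _ _ _ _ (Or.inl rfl), hz.single_add_apply]
  have h1 : conj D.p * D.vec z D.i₀ + conj D.r * D.vec z D.i₁ = 1 := by
    rw [vec, rot, block_apply_left D.ne, block_apply_right D.ne, h0]
    linear_combination D.unit_complex
  have h2 : 1 ≤ ‖D.vec z D.i₀‖ + ‖D.vec z D.i₁‖ := by
    calc (1 : ℝ) = ‖conj D.p * D.vec z D.i₀ + conj D.r * D.vec z D.i₁‖ := by rw [h1, norm_one]
      _ ≤ ‖D.p‖ * ‖D.vec z D.i₀‖ + ‖D.r‖ * ‖D.vec z D.i₁‖ := by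
          refine (norm_add_le _ _).trans_eq ?_
          rw [norm_mul, norm_mul, RCLike.norm_conj, RCLike.norm_conj]
      _ ≤ 1 * ‖D.vec z D.i₀‖ + 1 * ‖D.vec z D.i₁‖ := by
          gcongr
          · exact D.norm_p_le
          · exact D.norm_r_le
      _ = _ := by ring
  have h3 := (summable_norm_sq (D.vec z)).sum_le_tsum {D.i₀, D.i₁} (fun i _ => sq_nonneg _)
  rw [Finset.sum_pair D.ne.symm] at h3
  nlinarith [sq_nonneg (‖D.vec z D.i₀‖ - ‖D.vec z D.i₁‖)]

lemma norm_vec_sub_le (z z' : Ell1 ι) : ‖D.vec z - D.vec z'‖ ≤ 5 * ‖z - z'‖ := by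
  have h : D.vec z - D.vec z' = D.rot (D.scale (z - z')) := by
    simp [vec]
  rw [h]
  have : ‖D.rot (D.scale (z - z'))‖ ≤ 5 * (1 * ‖z - z'‖) :=
    D.rot.le_of_opNorm_le_of_le D.norm_rot_le (D.scale.le_of_opNorm_le D.norm_scale_le _)
  linarith

lemma vec_ne_zero {z : Ell1 ι} (hz : D.IsCorrection v w z) : D.vec z ≠ 0 := by
  intro h
  have := hz.half_le
  rw [h] at this
  norm_num at this

end IsCorrection

include hρ hw in
lemma exists_isCorrection : ∃ z, D.IsCorrection v w z := by
  obtain ⟨z, h1, h2⟩ := exists_correctionMap_eq D.norm_resolvent_le (D.norm_corrOp_le hw)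
    (D.norm_corrFun_le hw) (norm_single_one D.i₀) hρ.contraction
  exact ⟨z, h1, h2⟩

include hρ hw in
/-- Eigenvectors with eigenvalues near the model eigenvalue are multiples of the one constructed
from the correction. -/
lemma exists_eq_smul_vec (hv : D.IsCoupling v) {η : ℂ} {c : Ell1 ι} (hc0 : c ≠ 0)
    (hη : ‖η‖ < ‖D.β‖ / 10) (hc : D.IsEigen w η c) :
    ∃ z, D.IsCorrection v w z ∧ η = D.eigShift v w z ∧ ∃ t : ℂ, t ≠ 0 ∧ c = t • D.vec z := by
  set ε := D.smallness v ρ with hε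
  have hτ := D.τ_pos
  have hε0 : 0 ≤ ε := (norm_nonneg _).trans (D.norm_corrOp_le hw)
  have hε1 : ε ≤ 1 / 6 := by nlinarith [hρ.contraction]
  set x := D.scaleInv (D.rotInv c) with hx
  have hcx : D.rot (D.scale x) = c := by rw [hx, scale_scaleInv, rot_rotInv]
  rw [← hcx, isEigen_iff D hv] at hc
  obtain ⟨h1, h2⟩ := hc
  -- The window enters here: ‖η‖ < ‖β‖/10 and τ = 1/(2‖β‖).
  have hητ : ‖η‖ * D.τ ≤ 1 / 20 := by
    have := D.β_pos
    rw [τ, mul_one_div, div_le_iff₀ (by positivity)]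
    linarith
  have hres0 : D.resolvent x = D.resolvent (x - x D.i₀ • single D.i₀ 1) := by
    rw [map_sub, map_smul, IsCorrection.resolvent_single]; simp
  set z := x - x D.i₀ • single D.i₀ 1 with hz
  have hxz : x = x D.i₀ • single D.i₀ 1 + z := by rw [hz]; abel
  have hbound : ‖z‖ ≤ 1 / 20 * ‖z‖ + ε * ‖x‖ := by
    calc ‖z‖ = ‖η • D.resolvent z - D.corrOp v w x‖ := by rw [← hres0]; exact congrArg norm h2
      _ ≤ ‖η‖ * (D.τ * ‖z‖) + ε * ‖x‖ := by
          refine (norm_sub_le _ _).trans ?_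
          rw [norm_smul]
          gcongr
          · exact D.resolvent.le_of_opNorm_le D.norm_resolvent_le _
          · exact (D.corrOp v w).le_of_opNorm_le (D.norm_corrOp_le hw) _
      _ ≤ _ := by
          rw [← mul_assoc]
          gcongr
  have hxn : ‖x‖ ≤ ‖x D.i₀‖ + ‖z‖ := by
    calc ‖x‖ = ‖x D.i₀ • single D.i₀ 1 + z‖ := by rw [← hxz]
      _ ≤ ‖x D.i₀ • (single D.i₀ 1 : Ell1 ι)‖ + ‖z‖ := norm_add_le _ _
      _ ≤ _ := by
          rw [norm_smul]
          gcongr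
          exact mul_le_of_le_one_right (norm_nonneg _) (norm_single_one _)
  -- As 1/20 and ε ≤ 1/6 are small, the terms in ‖z‖ are absorbed on the left. So `x D.i₀` cannot
  -- vanish, and division by it puts the rest in the unit ball, as `IsCorrection` demands.
  have hzx : ‖z‖ ≤ ‖x D.i₀‖ := by
    have := norm_nonneg z
    have := norm_nonneg x
    nlinarith
  have hx0 : x D.i₀ ≠ 0 := by
    intro h
    rw [h, norm_zero] at hzx
    have : z = 0 := norm_le_zero_iff.1 hzx
    rw [h, this] at hxz
    apply hc0
    rw [← hcx, hxz]
    simp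
  set y := (x D.i₀)⁻¹ • z with hy
  have hxy : x = x D.i₀ • (single D.i₀ 1 + y) := by
    rw [smul_add, hy, smul_inv_smul₀ hx0, ← hxz]
  have hη' : η = D.eigShift v w y := by
    rw [eigShift]
    apply mul_left_cancel₀ hx0
    rw [mul_comm, h1]
    nth_rewrite 1 [hxy]
    rw [map_smul, smul_eq_mul]
  refine ⟨y, ⟨?_, ?_⟩, hη', x D.i₀, hx0, ?_⟩
  · rw [hy, norm_smul, norm_inv]
    rw [inv_mul_le_iff₀ (norm_pos_iff.2 hx0), mul_one]
    exact hzx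
  · rw [correctionMap, ← eigShift, ← hη']
    have h3 : single D.i₀ 1 + y = (x D.i₀)⁻¹ • x := by
      rw [hxy, smul_smul, ← hxy, inv_mul_cancel₀ hx0, one_smul]
    rw [h3, hy, map_smul, map_smul, smul_comm, ← smul_sub, ← hres0, ← h2]
  · rw [vec, ← map_smul, ← map_smul, ← hxy, hcx]

/-- The usual argument for symmetric operators: pair the equation with `c` and take imaginary parts.
-/
lemma im_eq_zero_of_isEigen (hw : reflect w = w) {η : ℂ} {c : Ell1 ι} (hc0 : c ≠ 0)
    (hc : D.IsEigen w η c) : η.im = 0 := by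
  set N : ℝ := ∑' i, ‖c i‖ ^ 2 with hN
  have hNpos : 0 < N := by
    obtain ⟨i, hi⟩ : ∃ i, c i ≠ 0 := by
      by_contra! h
      exact hc0 (lp.ext (funext h))
    exact (summable_norm_sq c).tsum_pos (fun i => sq_nonneg _) i
      (by have := norm_pos_iff.2 hi; positivity)
  -- The family `a i * c i` is not known to be summable in advance, `a` being unbounded; the
  -- equation exhibits it as this element of ℓ¹.
  set f : Ell1 ι := ((D.lam : ℂ) + η) • c - conv w c with hf
  have hfi : ∀ i, f i = D.a i * c i := by
    intro i
    rw [hf, lp.coeFn_sub, Pi.sub_apply, lp.coeFn_smul, Pi.smul_apply, smul_eq_mul, ← hc i]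
    ring
  have h1 : conj (dual c f) = dual c f := by
    rw [dual_apply, Complex.conj_tsum]
    refine tsum_congr fun i => ?_
    rw [hfi]
    simp only [map_mul, Complex.conj_conj, Complex.conj_ofReal]
    ring
  have h2 : dual c f = ((D.lam : ℂ) + η) * (N : ℝ) - dual c (conv w c) := by
    rw [hf, map_sub, map_smul, dual_self, smul_eq_mul]
  have h3 := conj_dual_conv hw c
  have h4 := congrArg Complex.im h2
  rw [Complex.conj_eq_iff_im] at h1 h3
  simp only [Complex.sub_im, Complex.mul_im, Complex.add_im, Complex.ofReal_im, Complex.ofReal_re,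
    h1, h3] at h4
  have h5 : η.im * N = 0 := by linarith
  exact (mul_eq_zero.1 h5).resolve_right hNpos.ne'

end TwoLevel

/-! ### Columns of rank-one projections and their Lipschitz dependence. -/

namespace Ell1

variable {ι : Type*}

/-- The `j`-th column of the orthogonal projection onto the line spanned by `c`. -/
def column (j : ι) (c : Ell1 ι) : Ell1 ι := (conj (c j) / ((∑' i, ‖c i‖ ^ 2 : ℝ) : ℂ)) • c

lemma abs_tsum_sq_sub_le {M : ℝ} {c d : Ell1 ι} (hc : ‖c‖ ≤ M) (hd : ‖d‖ ≤ M) :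
    |∑' i, ‖c i‖ ^ 2 - ∑' i, ‖d i‖ ^ 2| ≤ 2 * M * ‖c - d‖ := by
  have hM : 0 ≤ M := (norm_nonneg _).trans hc
  rw [← (summable_norm_sq c).tsum_sub (summable_norm_sq d), ← Real.norm_eq_abs, norm_eq (c - d),
    ← tsum_mul_left]
  refine tsum_of_norm_bounded ((summable_norm (c - d)).mul_left _).hasSum fun i => ?_
  have h1 : |‖c i‖ - ‖d i‖| ≤ ‖(c - d) i‖ := abs_norm_sub_norm_le _ _
  have h2 : ‖c i‖ + ‖d i‖ ≤ 2 * M := by linarith [norm_apply_le c i, norm_apply_le d i]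
  rw [Real.norm_eq_abs, sq_sub_sq, abs_mul, abs_of_nonneg (by positivity)]
  gcongr

lemma norm_coef_le {M : ℝ} {c : Ell1 ι} (j : ι) (hc : ‖c‖ ≤ M) (hN : 1 / 2 ≤ ∑' i, ‖c i‖ ^ 2) :
    ‖conj (c j) / ((∑' i, ‖c i‖ ^ 2 : ℝ) : ℂ)‖ ≤ 2 * M := by
  have hM : 0 ≤ M := (norm_nonneg _).trans hc
  rw [norm_div, RCLike.norm_conj, Complex.norm_real, Real.norm_eq_abs, abs_of_pos (by linarith),
    div_le_iff₀ (by linarith)]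
  nlinarith [norm_apply_le c j]

lemma norm_column_le {M : ℝ} {c : Ell1 ι} (j : ι) (hc : ‖c‖ ≤ M)
    (hN : 1 / 2 ≤ ∑' i, ‖c i‖ ^ 2) : ‖column j c‖ ≤ 2 * M * M := by
  have hM : 0 ≤ M := (norm_nonneg _).trans hc
  rw [column, norm_smul]
  gcongr
  exact norm_coef_le j hc hN

/-- The lower bound on both squared norms keeps the normalization Lipschitz. The coefficient
contributes 2 + 8M², and 2M + (2 + 8M²)M is the stated constant. -/
lemma norm_column_sub_le {M : ℝ} {c d : Ell1 ι} (j : ι) (hc : ‖c‖ ≤ M) (hd : ‖d‖ ≤ M)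
    (hN : 1 / 2 ≤ ∑' i, ‖c i‖ ^ 2) (hN' : 1 / 2 ≤ ∑' i, ‖d i‖ ^ 2) :
    ‖column j c - column j d‖ ≤ (4 * M + 8 * M ^ 3) * ‖c - d‖ := by
  have hM : 0 ≤ M := (norm_nonneg _).trans hc
  have hcoef := norm_coef_le j hc hN
  have hdiff := abs_tsum_sq_sub_le hc hd
  set N := ∑' i, ‖c i‖ ^ 2
  set N' := ∑' i, ‖d i‖ ^ 2
  have hNc : (N : ℂ) ≠ 0 := Complex.ofReal_ne_zero.2 (by linarith)
  have hNc' : (N' : ℂ) ≠ 0 := Complex.ofReal_ne_zero.2 (by linarith)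
  have hj : ‖c j - d j‖ ≤ ‖c - d‖ := by simpa using norm_apply_le (c - d) j
  have h1 : ‖conj (c j) / (N : ℂ) - conj (d j) / (N' : ℂ)‖ ≤ (2 + 8 * M ^ 2) * ‖c - d‖ := by
    have e : conj (c j) / (N : ℂ) - conj (d j) / (N' : ℂ) =
        conj (c j - d j) / N + conj (d j) * (((N' - N : ℝ) : ℂ)) / (N * N') := by
      rw [map_sub]
      push_cast
      field_simp
      ring
    have b1 : ‖conj (c j - d j) / (N : ℂ)‖ ≤ 2 * ‖c - d‖ := by
      rw [norm_div, RCLike.norm_conj, Complex.norm_real, Real.norm_eq_abs,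
        abs_of_pos (by linarith), div_le_iff₀ (by linarith)]
      nlinarith [norm_nonneg (c - d)]
    have b2 : ‖conj (d j) * (((N' - N : ℝ) : ℂ)) / ((N : ℂ) * N')‖ ≤
        8 * M ^ 2 * ‖c - d‖ := by
      rw [norm_div, norm_mul, norm_mul, RCLike.norm_conj, Complex.norm_real, Complex.norm_real,
        Complex.norm_real, Real.norm_eq_abs, Real.norm_eq_abs, Real.norm_eq_abs,
        abs_of_pos (by linarith : 0 < N), abs_of_pos (by linarith : 0 < N'),
        div_le_iff₀ (mul_pos (by linarith) (by linarith)), abs_sub_comm]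
      have h4 : 1 / 4 ≤ N * N' := by nlinarith
      calc ‖d j‖ * |N - N'| ≤ M * (2 * M * ‖c - d‖) := by
            gcongr
            exact (norm_apply_le d j).trans hd
        _ = 8 * M ^ 2 * ‖c - d‖ * (1 / 4) := by ring
        _ ≤ _ := by gcongr
    rw [e]
    exact (norm_add_le _ _).trans (by linarith)
  have e : column j c - column j d = (conj (c j) / (N : ℂ)) • (c - d) +
      (conj (c j) / (N : ℂ) - conj (d j) / (N' : ℂ)) • d := by
    simp only [column, smul_sub, sub_smul]
    abel
  rw [e]
  calc _ ≤ 2 * M * ‖c - d‖ + (2 + 8 * M ^ 2) * ‖c - d‖ * M := by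
        refine (norm_add_le _ _).trans ?_
        rw [norm_smul, norm_smul]
        gcongr
    _ = _ := by ring

end Ell1

/-! ### The iteration of potentials. -/

namespace TwoLevel

open Ell1

variable {ι : Type*} [DecidableEq ι] [AddCommGroup ι] (D : TwoLevel ι) (v w : Ell1 ι)

open Classical in
/-- The correction for the potential `w`, if there is one. -/
def correction : Ell1 ι := if h : ∃ z, D.IsCorrection v w z then h.choose else 0

/-- The map `W ↦ V + κ |E_W e_j|²`. -/
def nextPotential (κ : ℝ) : Ell1 ι :=
  v + (κ : ℂ) • conv (column D.i₀ (D.vec (D.correction v w)))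
    (reflect (column D.i₀ (D.vec (D.correction v w))))

variable {D v w} {ρ : ℝ} (hρ : D.IsSmall v ρ) (hw : ‖w - v‖ ≤ ρ)

include hρ hw in
lemma isCorrection_correction : D.IsCorrection v w (D.correction v w) := by
  have h := exists_isCorrection hρ hw
  rw [correction, dif_pos h]
  exact h.choose_spec

include hρ hw in
lemma norm_column_vec_le : ‖column D.i₀ (D.vec (D.correction v w))‖ ≤ 200 := by
  have h := isCorrection_correction hρ hw
  exact (norm_column_le _ h.norm_vec_le h.half_le).trans (by norm_num)

include hρ hw in
lemma norm_nextPotential_sub_self_le (κ : ℝ) : ‖D.nextPotential v w κ - v‖ ≤ |κ| * 40000 := by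
  have h := norm_column_vec_le hρ hw
  rw [nextPotential, add_sub_cancel_left, norm_smul, Complex.norm_real, Real.norm_eq_abs]
  gcongr
  calc _ ≤ _ := norm_conv_reflect_le _ _
    _ ≤ (200 * 200 : ℝ) := by gcongr
    _ = _ := by norm_num

include hρ hw in
-- Here 400 = 200 + 200 comes from the quadratic dependence on the column, 8040 = 4·10 + 8·10³ from
-- `norm_column_sub_le` with M = 10, and 1000τ = 5·200τ from the vector and its correction.
lemma norm_nextPotential_sub_le {w' : Ell1 ι} (hw' : ‖w' - v‖ ≤ ρ) (κ : ℝ) :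
    ‖D.nextPotential v w κ - D.nextPotential v w' κ‖ ≤
      |κ| * (400 * 8040 * 1000 * D.τ) * ‖w - w'‖ := by
  have h := isCorrection_correction hρ hw
  have h' := isCorrection_correction hρ hw'
  have h1 := h.norm_sub_le hρ hw h'
  have h2 := IsCorrection.norm_vec_sub_le (D := D) (D.correction v w) (D.correction v w')
  have h3 := norm_column_sub_le D.i₀ h.norm_vec_le h'.norm_vec_le h.half_le h'.half_le
  have h4 := norm_column_vec_le hρ hw
  have h5 := norm_column_vec_le hρ hw'
  have h6 := norm_conv_reflect_sub_le (column D.i₀ (D.vec (D.correction v w)))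
    (column D.i₀ (D.vec (D.correction v w')))
  have e : D.nextPotential v w κ - D.nextPotential v w' κ = (κ : ℂ) •
      (conv (column D.i₀ (D.vec (D.correction v w)))
          (reflect (column D.i₀ (D.vec (D.correction v w)))) -
        conv (column D.i₀ (D.vec (D.correction v w')))
          (reflect (column D.i₀ (D.vec (D.correction v w'))))) := by
    rw [nextPotential, nextPotential, smul_sub]; abel
  rw [e, norm_smul, Complex.norm_real, Real.norm_eq_abs, mul_assoc]
  gcongr
  calc _ ≤ _ := h6
    _ ≤ (200 + 200) * ((4 * 10 + 8 * 10 ^ 3) * (5 * (200 * D.τ * ‖w - w'‖))) := by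
        gcongr
        exact h3.trans (by gcongr; exact h2.trans (by gcongr))
    _ = _ := by ring

lemma reflect_nextPotential (hv : reflect v = v) (κ : ℝ) :
    reflect (D.nextPotential v w κ) = D.nextPotential v w κ := by
  set u := column D.i₀ (D.vec (D.correction v w)) with hu
  have h := reflect_conv_reflect u
  ext i
  have h1 := congrArg (fun f : Ell1 ι => f i) h
  have h2 := congrArg (fun f : Ell1 ι => f i) hv
  simp only [reflect_apply] at h1 h2
  rw [reflect_apply, nextPotential, ← hu]
  simp only [lp.coeFn_add, Pi.add_apply, lp.coeFn_smul, Pi.smul_apply, smul_eq_mul, map_add,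
    map_mul, Complex.conj_ofReal, h1, h2]

/-- The successive approximations converge to a fixed point. -/
lemma exists_limit (hρ : D.IsSmall v ρ) (hv : reflect v = v) {κ : ℝ}
    (hκ₁ : |κ| * 40000 ≤ ρ) (hκ₂ : |κ| * (400 * 8040 * 1000 * D.τ) ≤ 1 / 2) :
    ∃ w : Ell1 ι, ‖w - v‖ ≤ ρ ∧ reflect w = w ∧ D.nextPotential v w κ = w ∧
      (∀ m, ‖(fun w => D.nextPotential v w κ)^[m] v - v‖ ≤ ρ ∧
        reflect ((fun w => D.nextPotential v w κ)^[m] v) =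
          (fun w => D.nextPotential v w κ)^[m] v) ∧
      Tendsto (fun m => (fun w => D.nextPotential v w κ)^[m] v) atTop (𝓝 w) := by
  have hρ0 : 0 ≤ ρ := le_trans (by positivity) hκ₁
  set Φ := fun w => D.nextPotential v w κ with hΦ
  -- Reality is a closed condition, so building it into the domain gives it to the limit as well.
  set s : Set (Ell1 ι) := Metric.closedBall v ρ ∩ {w | reflect w = w} with hs
  have hsv : v ∈ s := ⟨by simpa using hρ0, hv⟩
  have hcont : Continuous (reflect : Ell1 ι → Ell1 ι) := by
    refine (LipschitzWith.of_dist_le_mul (K := 1) fun f g => ?_).continuous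
    rw [dist_eq_norm, dist_eq_norm, ← reflect_sub, norm_reflect]; simp
  have hsc : IsComplete s :=
    (Metric.isClosed_closedBall.inter (isClosed_eq hcont continuous_id)).isComplete
  have hmaps : Set.MapsTo Φ s s := by
    rintro w ⟨h1, -⟩
    rw [mem_closedBall_iff_norm] at h1
    refine ⟨?_, reflect_nextPotential hv κ⟩
    rw [mem_closedBall_iff_norm]
    exact (norm_nextPotential_sub_self_le hρ h1 κ).trans hκ₁
  have hc : ContractingWith (1 / 2) (hmaps.restrict _ _ _) := by
    refine ⟨by norm_num, LipschitzWith.of_dist_le_mul ?_⟩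
    rintro ⟨x, hx, -⟩ ⟨y, hy, -⟩
    rw [mem_closedBall_iff_norm] at hx hy
    rw [Subtype.dist_eq, Subtype.dist_eq, dist_eq_norm, dist_eq_norm]
    refine (norm_nextPotential_sub_le hρ hx hy κ).trans ?_
    norm_num at hκ₂ ⊢
    gcongr
  obtain ⟨w, ⟨h1, h2⟩, hfix, hlim, -⟩ := hc.exists_fixedPoint' hsc hmaps hsv (edist_ne_top _ _)
  refine ⟨w, mem_closedBall_iff_norm.1 h1, h2, hfix, fun m => ?_, hlim⟩
  obtain ⟨h3, h4⟩ := hmaps.iterate m hsv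
  exact ⟨mem_closedBall_iff_norm.1 h3, h4⟩

end TwoLevel

/-! ### Passage from ℓ¹ to ℓ²: the spectral subspace and the potential map. -/

open Ell1

/-- The element of `ℓ²(ℤⁿ)` given by a square summable family. -/
def ell2Mk {n : ℕ} (f : Lat n → ℂ) (hf : Memℓp f 2) : Ell2 n := ⟨f, hf⟩

lemma ell2Mk_apply {n : ℕ} (f : Lat n → ℂ) (hf : Memℓp f 2) (m : Lat n) : ell2Mk f hf m = f m := rfl

/-- The inclusion of `ℓ¹(ℤⁿ)` in `ℓ²(ℤⁿ)`. -/
def toEll2 {n : ℕ} (c : Ell1 (Lat n)) : Ell2 n :=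
  ell2Mk c ((lp.memℓp c).of_exponent_ge (by norm_num))

@[simp] lemma toEll2_apply {n : ℕ} (c : Ell1 (Lat n)) (m : Lat n) : toEll2 c m = c m := by
  rw [toEll2, ell2Mk_apply]

lemma toEll2_smul {n : ℕ} (x : ℂ) (c : Ell1 (Lat n)) : toEll2 (x • c) = x • toEll2 c := by
  ext m
  rw [toEll2_apply, lp.coeFn_smul, lp.coeFn_smul, Pi.smul_apply, Pi.smul_apply, toEll2_apply]

lemma norm_toEll2_sq {n : ℕ} (c : Ell1 (Lat n)) : ‖toEll2 c‖ ^ 2 = ∑' i, ‖c i‖ ^ 2 := by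
  have := lp.norm_rpow_eq_tsum (p := 2) (by norm_num) (toEll2 c)
  simpa using this

/-- The trigonometric polynomial as an element of `ℓ¹(ℤⁿ)`. -/
def ofFinsupp {n : ℕ} (v : Lat n →₀ ℂ) : Ell1 (Lat n) :=
  Ell1.mk v (summable_of_ne_finset_zero (s := v.support) (by simp))

@[simp] lemma ofFinsupp_apply {n : ℕ} (v : Lat n →₀ ℂ) (m : Lat n) : ofFinsupp v m = v m := rfl

lemma norm_tsum_conv_le {n : ℕ} (w : Ell1 (Lat n)) (c : Ell2 n) (m : Lat n) :
    ‖∑' r, w (m - r) * c r‖ ≤ ‖w‖ * ‖c‖ := by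
  rw [Ell1.norm_eq, ← tsum_mul_right]
  have hs := (summable_norm w).mul_right ‖c‖
  refine tsum_of_norm_bounded ((Equiv.subLeft m).hasSum_iff.2 hs.hasSum) fun r => ?_
  simp only [norm_mul, Function.comp_apply, Equiv.subLeft_apply]
  gcongr
  exact lp.norm_apply_le_norm (by simp) c r

/-- At such a remote site the diagonal entry minus `μ` is more than half of `1 + waveLen m t ^ (2 *
l)`, while the convolution is bounded by ‖w‖‖c‖ uniformly in `m`. -/
lemma norm_apply_le_of_isEigenvector {n l : ℕ} {t : Rn n} {w : Ell1 (Lat n)} {μ : ℝ}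
    {c : Ell2 n} (hc : IsEigenvector l t w μ c) {m : Lat n}
    (hm : 2 * |μ| + 2 < 1 + waveLen m t ^ (2 * l)) :
    ‖c m‖ ≤ 2 * (‖w‖ * ‖c‖) * (1 + waveLen m t ^ (2 * l))⁻¹ := by
  have h2 := hc m
  have h3 := norm_tsum_conv_le w c m
  generalize waveLen m t ^ (2 * l) = a at hm h2 ⊢
  have h4 : ((a - μ : ℝ) : ℂ) * c m = -∑' r, w (m - r) * c r := by
    push_cast
    linear_combination h2
  have h5 := congrArg norm h4
  rw [norm_neg, norm_mul, Complex.norm_real, Real.norm_eq_abs,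
    abs_of_pos (by linarith [le_abs_self μ, abs_nonneg μ])] at h5
  have h6 : 0 < 1 + a := by linarith [abs_nonneg μ]
  rw [← div_eq_mul_inv, le_div_iff₀ h6]
  nlinarith [le_abs_self μ, abs_nonneg μ, norm_nonneg (c m)]

/-- Thus every ℓ² eigenvector lies in ℓ¹, and the uniqueness established there controls the whole
spectral subspace. -/
lemma summable_of_isEigenvector {n l : ℕ} {t : Rn n}
    (hsum : Summable fun m : Lat n => (1 + waveLen m t ^ (2 * l))⁻¹) {w : Ell1 (Lat n)} {μ : ℝ}
    {c : Ell2 n} (hc : IsEigenvector l t w μ c) : Summable fun m => ‖c m‖ := by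
  have hev : ∀ᶠ m : Lat n in cofinite, (1 + waveLen m t ^ (2 * l))⁻¹ < (2 * |μ| + 2)⁻¹ :=
    hsum.tendsto_cofinite_zero.eventually_lt_const (by positivity)
  refine Summable.of_norm_bounded_eventually (hsum.mul_left (2 * (‖w‖ * ‖c‖))) ?_
  filter_upwards [hev] with m hm
  have h1 : 0 ≤ waveLen m t ^ (2 * l) := pow_nonneg (norm_nonneg _) _
  rw [inv_lt_inv₀ (by positivity) (by positivity)] at hm
  rw [norm_norm]
  exact norm_apply_le_of_isEigenvector hc hm

lemma exists_toEll2_eq {n l : ℕ} {t : Rn n}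
    (hsum : Summable fun m : Lat n => (1 + waveLen m t ^ (2 * l))⁻¹) {w : Ell1 (Lat n)} {μ : ℝ}
    {c : Ell2 n} (hc : IsEigenvector l t w μ c) : ∃ c' : Ell1 (Lat n), toEll2 c' = c :=
  ⟨Ell1.mk _ (summable_of_isEigenvector hsum hc), by ext m; rw [toEll2_apply, mk_apply]⟩

/-- The two-level data of the problem at the quasimomentum `t`. -/
structure Represents {n : ℕ} (D : TwoLevel (Lat n)) (l : ℕ) (v : Lat n →₀ ℂ) (q : Lat n)
    (s : ℤˣ) (j : Lat n) (t : Rn n) : Prop where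
  left : D.i₀ = j
  right : D.i₁ = j - q
  diag : ∀ m, D.a m = waveLen m t ^ (2 * l)
  coupling : D.β = v q
  eigenvalue : D.lam = modelEigenvalue l v q s j t
  summable : Summable fun m : Lat n => (1 + waveLen m t ^ (2 * l))⁻¹

namespace Represents

variable {n : ℕ} {D : TwoLevel (Lat n)} {l : ℕ} {v : Lat n →₀ ℂ} {q : Lat n} {s : ℤˣ}
  {j : Lat n} {t : Rn n} (h : Represents D l v q s j t) {w : Ell1 (Lat n)} {ρ : ℝ}

include h

lemma isEigenvector_iff (μ : ℝ) (c : Ell1 (Lat n)) :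
    IsEigenvector l t w μ (toEll2 c) ↔ D.IsEigen w ((μ - D.lam : ℝ) : ℂ) c := by
  refine forall_congr' fun m => ?_
  rw [conv_apply, h.diag]
  simp

lemma isCoupling (hv0 : v 0 = 0) (hvreal : ∀ m, v (-m) = conj (v m)) :
    D.IsCoupling (ofFinsupp v) where
  zero := hv0
  right := by rw [h.left, h.right, h.coupling, ofFinsupp_apply, sub_sub_cancel]
  left := by
    rw [h.left, h.right, h.coupling, ofFinsupp_apply, sub_sub_cancel_left, hvreal]

variable (hv : D.IsCoupling (ofFinsupp v)) (hρ : D.IsSmall (ofFinsupp v) ρ)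
  (hw : ‖w - ofFinsupp v‖ ≤ ρ) (hwr : reflect w = w)

include hv hρ hw hwr

lemma exists_eigenvalue : ∃ μ : ℝ, |μ - modelEigenvalue l v q s j t| < ‖v q‖ / 10 ∧
    IsEigenvector l t w μ (toEll2 (D.vec (D.correction (ofFinsupp v) w))) := by
  have hz := TwoLevel.isCorrection_correction hρ hw
  set z := D.correction (ofFinsupp v) w
  have he := hz.isEigen hv
  have him := TwoLevel.im_eq_zero_of_isEigen hwr hz.vec_ne_zero he
  set η := D.eigShift (ofFinsupp v) w z with hη
  have hre : ((η.re : ℝ) : ℂ) = η := Complex.ext rfl (by simp [him])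
  refine ⟨D.lam + η.re, ?_, ?_⟩
  · rw [← h.eigenvalue, add_sub_cancel_left, ← h.coupling, ← Real.norm_eq_abs,
      ← Complex.norm_real, hre]
    exact hz.norm_eigShift_lt hρ hw
  · rw [h.isEigenvector_iff, add_sub_cancel_left, hre]
    exact he

lemma exists_smul_of_isEigenvector {μ : ℝ} (hμ : |μ - modelEigenvalue l v q s j t| < ‖v q‖ / 10)
    {c : Ell2 n} (hc : IsEigenvector l t w μ c) :
    ∃ x : ℂ, c = x • toEll2 (D.vec (D.correction (ofFinsupp v) w)) := by
  by_cases hc0 : c = 0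
  · exact ⟨0, by rw [hc0, zero_smul]⟩
  obtain ⟨c, rfl⟩ := exists_toEll2_eq h.summable hc
  rw [h.isEigenvector_iff] at hc
  have hc0' : c ≠ 0 := by 
    rintro rfl
    apply hc0
    ext m
    rw [toEll2_apply, lp.coeFn_zero, lp.coeFn_zero, Pi.zero_apply]
  obtain ⟨z, hz, -, x, -, hx⟩ := TwoLevel.exists_eq_smul_vec hρ hw hv hc0' (by
    rw [Complex.norm_real, Real.norm_eq_abs, h.eigenvalue, h.coupling]; exact hμ) hc
  rw [hz.unique hρ hw (TwoLevel.isCorrection_correction hρ hw)] at hx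
  exact ⟨x, by rw [hx, toEll2_smul]⟩

/-- All eigenvectors in the window are multiples of a single one, so the span is a line, and the
closure in the definition adds nothing. -/
lemma spectralSubspace_eq : spectralSubspace l v q s j t w =
    Submodule.span ℂ {toEll2 (D.vec (D.correction (ofFinsupp v) w))} := by
  obtain ⟨μ, hμ, he⟩ := h.exists_eigenvalue hv hρ hw hwr
  have h1 : Submodule.span ℂ {c : Ell2 n | ∃ μ : ℝ, |μ - modelEigenvalue l v q s j t| <
      ‖v q‖ / 10 ∧ IsEigenvector l t w μ c} =
      Submodule.span ℂ {toEll2 (D.vec (D.correction (ofFinsupp v) w))} := by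
    apply le_antisymm
    · rw [Submodule.span_le]
      rintro c ⟨μ', hμ', hc⟩
      obtain ⟨x, rfl⟩ := h.exists_smul_of_isEigenvector hv hρ hw hwr hμ' hc
      exact Submodule.smul_mem _ _ (Submodule.mem_span_singleton_self _)
    · rw [Submodule.span_singleton_le_iff_mem]
      exact Submodule.subset_span ⟨μ, hμ, he⟩
  rw [spectralSubspace, h1]
  exact (Submodule.closed_of_finiteDimensional _).submodule_topologicalClosure_eq

lemma toEll2_vec_ne_zero : toEll2 (D.vec (D.correction (ofFinsupp v) w)) ≠ 0 := by
  intro h0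
  have hz := TwoLevel.isCorrection_correction hρ hw
  apply hz.vec_ne_zero
  ext m
  rw [← toEll2_apply, h0, lp.coeFn_zero, lp.coeFn_zero, Pi.zero_apply]

lemma finrank_spectralSubspace : Module.finrank ℂ (spectralSubspace l v q s j t w) = 1 := by
  rw [h.spectralSubspace_eq hv hρ hw hwr]
  exact finrank_span_singleton (h.toEll2_vec_ne_zero hv hρ hw hwr)

lemma isNearEigenvalue : ∃ μ : ℝ, IsNearEigenvalue l v q s j t w μ ∧
    IsEigenvector l t w μ (toEll2 (D.vec (D.correction (ofFinsupp v) w))) := by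
  obtain ⟨μ, hμ, he⟩ := h.exists_eigenvalue hv hρ hw hwr
  exact ⟨μ, ⟨hμ, _, h.toEll2_vec_ne_zero hv hρ hw hwr, he⟩, he⟩

lemma waveCoeff_eq (A : ℂ) (m : Lat n) : waveCoeff l v q s j t A w m =
    A * column D.i₀ (D.vec (D.correction (ofFinsupp v) w)) m := by
  -- Stated for a variable subspace, so that the projection instance is transported along with the
  -- equality.
  have key : ∀ (U : Submodule ℂ (Ell2 n)) [U.HasOrthogonalProjection] (c : Ell1 (Lat n)),
      U = Submodule.span ℂ {toEll2 c} →
      (U.starProjection (lp.single 2 j (1 : ℂ)) : Ell2 n) m = column j c m := by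
    intro U _ c hU
    subst hU
    rw [Submodule.starProjection_singleton, norm_toEll2_sq, lp.inner_single_right, column]
    simp
  rw [waveCoeff, key _ _ (h.spectralSubspace_eq hv hρ hw hwr), h.left]

/-- The phase of `A` cancels in |û_W|², leaving the single real parameter σ|A|². -/
lemma potentialMap_eq (σ : ℝ) (A : ℂ) (m : Lat n) : potentialMap l v q s j t σ A w m =
    D.nextPotential (ofFinsupp v) w (σ * ‖A‖ ^ 2) m := by
  rw [potentialMap, TwoLevel.nextPotential]
  simp only [h.waveCoeff_eq hv hρ hw hwr, lp.coeFn_add, Pi.add_apply, lp.coeFn_smul,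
    Pi.smul_apply, smul_eq_mul, conv_reflect_apply, ofFinsupp_apply, map_mul]
  push_cast
  rw [← Complex.mul_conj', ← tsum_mul_left, ← tsum_mul_left]
  exact congrArg (fun x => v m + x) (tsum_congr fun r => by ring)

end Represents

/-! ### Plane wave series and classical solutions. -/

section PlaneWave

/-- The plane wave `exp(i⟨P_m(t), x⟩)`. -/
def planeWave {n : ℕ} (t : Rn n) (m : Lat n) (x : Rn n) : ℂ :=
  Complex.exp (Complex.I * ((⟪waveVec m t, x⟫_ℝ : ℝ) : ℂ))

/-- The sum of the plane wave series with the given coefficients. -/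
def waveSeries {n : ℕ} (t : Rn n) (c : Lat n → ℂ) (x : Rn n) : ℂ :=
  ∑' m : Lat n, c m * planeWave t m x

lemma iteratedDeriv_exp_I (k : ℕ) : iteratedDeriv k (fun s : ℝ => Complex.exp (Complex.I * s)) =
    fun s : ℝ => Complex.I ^ k * Complex.exp (Complex.I * s) := by
  induction k with
  | zero => simp
  | succ k ih =>
    rw [iteratedDeriv_succ, ih]
    funext s
    have h : HasDerivAt (fun s : ℝ => Complex.exp (Complex.I * s))
        (Complex.exp (Complex.I * s) * (Complex.I * 1)) s :=
      ((Complex.ofRealCLM.hasDerivAt (x := s)).const_mul Complex.I).cexp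
    rw [(h.const_mul (Complex.I ^ k)).deriv]
    ring

lemma contDiff_exp_I {N : WithTop ℕ∞} : ContDiff ℝ N (fun s : ℝ => Complex.exp (Complex.I * s)) :=
  (contDiff_const.mul Complex.ofRealCLM.contDiff).cexp

variable {n : ℕ} (t : Rn n)

lemma planeWave_eq (m : Lat n) : planeWave t m =
    (fun s : ℝ => Complex.exp (Complex.I * s)) ∘ (innerSL ℝ (waveVec m t)) := rfl

lemma contDiff_planeWave {N : WithTop ℕ∞} (m : Lat n) : ContDiff ℝ N (planeWave t m) := by
  rw [planeWave_eq]
  exact contDiff_exp_I.comp (innerSL ℝ (waveVec m t)).contDiff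

lemma norm_planeWave (m : Lat n) (x : Rn n) : ‖planeWave t m x‖ = 1 := by
  rw [planeWave, mul_comm, Complex.norm_exp_ofReal_mul_I]

lemma iteratedFDeriv_planeWave_apply (k : ℕ) (m : Lat n) (x : Rn n) (y : Fin k → Rn n) :
    iteratedFDeriv ℝ k (planeWave t m) x y =
      (∏ i, (⟪waveVec m t, y i⟫_ℝ : ℝ)) • (Complex.I ^ k * planeWave t m x) := by
  rw [planeWave_eq, ContinuousLinearMap.iteratedFDeriv_comp_right _ contDiff_exp_I x (i := k)
    (n := ((k : ℕ∞) : WithTop ℕ∞)) le_rfl]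
  rw [ContinuousMultilinearMap.compContinuousLinearMap_apply,
    iteratedFDeriv_apply_eq_iteratedDeriv_mul_prod, iteratedDeriv_exp_I]
  rfl

lemma norm_iteratedFDeriv_planeWave_le (k : ℕ) (m : Lat n) (x : Rn n) :
    ‖iteratedFDeriv ℝ k (planeWave t m) x‖ ≤ waveLen m t ^ k := by
  refine ContinuousMultilinearMap.opNorm_le_bound (pow_nonneg (norm_nonneg _) _) fun y => ?_
  rw [iteratedFDeriv_planeWave_apply, norm_smul, norm_mul, norm_planeWave, norm_pow,
    Complex.norm_I, one_pow, mul_one, mul_one, norm_prod]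
  calc ∏ i, ‖(⟪waveVec m t, y i⟫_ℝ : ℝ)‖ ≤ ∏ i, (waveLen m t * ‖y i‖) :=
        Finset.prod_le_prod (fun i _ => norm_nonneg _) fun i _ => norm_inner_le_norm _ _
    _ = _ := by rw [Finset.prod_mul_distrib]; simp

variable {t} {c : Lat n → ℂ}

lemma norm_iteratedFDeriv_term_le (k : ℕ) (m : Lat n) (x : Rn n) :
    ‖iteratedFDeriv ℝ k (fun x => c m * planeWave t m x) x‖ ≤ ‖c m‖ * waveLen m t ^ k := by
  have h : (fun x => c m * planeWave t m x) = c m • planeWave t m := rfl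
  rw [h, iteratedFDeriv_const_smul_apply (contDiff_planeWave t m).contDiffAt, norm_smul]
  gcongr
  exact norm_iteratedFDeriv_planeWave_le t k m x

lemma contDiff_waveSeries {N : ℕ} (hc : ∀ k ≤ N, Summable fun m => ‖c m‖ * waveLen m t ^ k) :
    ContDiff ℝ N (waveSeries t c) := by
  refine contDiff_tsum (v := fun k m => ‖c m‖ * waveLen m t ^ k) (N := (N : ℕ∞))
    (fun m => contDiff_const.mul (contDiff_planeWave t m)) (fun k hk => hc k (by exact_mod_cast hk))
    fun k m x _ => norm_iteratedFDeriv_term_le k m x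

/-- Two moments of the coefficients permit termwise differentiation, and the squared components of
P_m add up to p_m². -/
lemma neg_laplacian_waveSeries (hc : ∀ k ≤ 2, Summable fun m => ‖c m‖ * waveLen m t ^ k) :
    -Laplacian.laplacian (waveSeries t c) =
      waveSeries t fun m => (waveLen m t ^ 2 : ℝ) * c m := by
  funext x
  have h2 : ∀ e : Rn n, iteratedFDeriv ℝ 2 (waveSeries t c) x ![e, e] =
      ∑' m, -((⟪waveVec m t, e⟫_ℝ ^ 2 : ℝ) : ℂ) * (c m * planeWave t m x) ∧
      Summable fun m => -((⟪waveVec m t, e⟫_ℝ ^ 2 : ℝ) : ℂ) * (c m * planeWave t m x) := by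
    intro e
    have h3 := iteratedFDeriv_tsum_apply (𝕜 := ℝ) (N := (2 : ℕ∞))
      (f := fun m x => c m * planeWave t m x)
      (fun m => contDiff_const.mul (contDiff_planeWave t m))
      (v := fun k m => ‖c m‖ * waveLen m t ^ k)
      (fun k hk => hc k (by exact_mod_cast hk)) (fun k m x _ => norm_iteratedFDeriv_term_le k m x)
      (k := 2) le_rfl x
    have hs : Summable fun m => iteratedFDeriv ℝ 2 (fun x => c m * planeWave t m x) x :=
      Summable.of_norm_bounded (hc 2 le_rfl) fun m => norm_iteratedFDeriv_term_le 2 m x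
    have hterm : ∀ m, iteratedFDeriv ℝ 2 (fun x => c m * planeWave t m x) x ![e, e] =
        -((⟪waveVec m t, e⟫_ℝ ^ 2 : ℝ) : ℂ) * (c m * planeWave t m x) := by
      intro m
      have h : (fun x => c m * planeWave t m x) = c m • planeWave t m := rfl
      rw [h, iteratedFDeriv_const_smul_apply (contDiff_planeWave t m).contDiffAt,
        smul_apply, iteratedFDeriv_planeWave_apply]
      simp [Fin.prod_univ_two]
      ring
    have hmap := (ContinuousMultilinearMap.apply ℝ (fun _ : Fin 2 => Rn n) ℂ ![e, e]).map_tsum hs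
    have hsum := (ContinuousMultilinearMap.apply ℝ (fun _ : Fin 2 => Rn n) ℂ ![e, e]).summable hs
    simp only [ContinuousMultilinearMap.apply_apply, hterm] at hmap hsum
    refine ⟨?_, hsum⟩
    rw [← hmap, ← h3]
    rfl
  rw [Pi.neg_apply, InnerProductSpace.laplacian_eq_iteratedFDeriv_orthonormalBasis _
    (EuclideanSpace.basisFun (Fin n) ℝ)]
  simp only [(h2 _).1]
  rw [← Summable.tsum_finsetSum (fun i _ => (h2 _).2), ← tsum_neg]
  refine tsum_congr fun m => ?_
  rw [← Finset.sum_mul, Finset.sum_neg_distrib, ← Complex.ofReal_sum]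
  have h5 : ∑ i, ⟪waveVec m t, EuclideanSpace.basisFun (Fin n) ℝ i⟫_ℝ ^ 2 = waveLen m t ^ 2 := by
    rw [waveLen, EuclideanSpace.real_norm_sq_eq]
    simp [EuclideanSpace.inner_single_right]
  rw [h5]
  ring

/-- Each Laplacian uses up two of the moments and changes the coefficients, hence the induction over
all `c`. -/
lemma iterate_neg_laplacian_waveSeries (l : ℕ)
    (hc : ∀ k ≤ 2 * l, Summable fun m => ‖c m‖ * waveLen m t ^ k) :
    (fun f : Rn n → ℂ => -Laplacian.laplacian f)^[l] (waveSeries t c) =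
      waveSeries t fun m => (waveLen m t ^ (2 * l) : ℝ) * c m := by
  induction l generalizing c with
  | zero => simp
  | succ l ih =>
    rw [Function.iterate_succ_apply, neg_laplacian_waveSeries fun k hk => hc k (by omega), ih]
    · congr 1
      funext m
      push_cast
      ring
    · intro k hk
      refine (hc (k + 2) (by omega)).congr fun m => ?_
      have : 0 ≤ waveLen m t := norm_nonneg _
      rw [norm_mul, Complex.norm_real, Real.norm_eq_abs, abs_of_nonneg (by positivity)]
      ring

lemma planeWave_add (t t' : Rn n) (m i : Lat n) (x : Rn n) :
    planeWave (t + t') (i + m) x = planeWave t m x * planeWave t' i x := by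
  have h : waveVec (i + m) (t + t') = waveVec m t + waveVec i t' := by
    ext k; simp [waveVec]; ring
  rw [planeWave, h, inner_add_left, planeWave, planeWave, ← Complex.exp_add]
  push_cast
  ring_nf

lemma conj_planeWave (t : Rn n) (m : Lat n) (x : Rn n) :
    conj (planeWave t m x) = planeWave (-t) (-m) x := by
  have h : waveVec (-m) (-t) = -waveVec m t := by
    ext k; simp [waveVec]; ring
  rw [planeWave, planeWave, h, inner_neg_left, ← Complex.exp_conj]
  simp

lemma planeWave_translate (t : Rn n) (m : Lat n) (x : Rn n) (i : Fin n) :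
    planeWave t m (x + EuclideanSpace.single i (2 * Real.pi)) =
      Complex.exp (2 * Real.pi * Complex.I * (t i : ℂ)) * planeWave t m x := by
  rw [planeWave, planeWave, ← Complex.exp_add, inner_add_right]
  have h : ⟪waveVec m t, EuclideanSpace.single i (2 * Real.pi)⟫_ℝ = 2 * Real.pi * (m i + t i) := by
    rw [EuclideanSpace.inner_single_right]
    simp [waveVec]
  rw [h, Complex.exp_eq_exp_iff_exists_int]
  exact ⟨m i, by push_cast; ring⟩

/-- The value at `x` of the plane wave series, as a functional of the coefficients. -/
def evalWave (t x : Rn n) : Ell1 (Lat n) →L[ℂ] ℂ :=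
  pairing (fun m => planeWave t m x) fun m => (norm_planeWave t m x).le

lemma evalWave_apply (t x : Rn n) (c : Ell1 (Lat n)) : evalWave t x c = waveSeries t c x := by
  rw [evalWave, pairing_apply, waveSeries]
  exact tsum_congr fun m => mul_comm _ _

lemma waveSeries_conv (t t' x : Rn n) (w c : Ell1 (Lat n)) :
    waveSeries (t + t') (conv w c) x = waveSeries t w x * waveSeries t' c x := by
  simp only [← evalWave_apply]
  exact pairing_conv _ _ _ _ _ _ (fun m i => planeWave_add t t' m i x) w c

lemma waveSeries_reflect (t x : Rn n) (c : Ell1 (Lat n)) :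
    waveSeries (-t) (reflect c) x = conj (waveSeries t c x) := by
  rw [waveSeries, waveSeries, Complex.conj_tsum, ← (Equiv.neg (Lat n)).tsum_eq]
  refine tsum_congr fun m => ?_
  simp [conj_planeWave]

lemma waveSeries_zero_ofFinsupp (v : Lat n →₀ ℂ) (x : Rn n) :
    waveSeries 0 (ofFinsupp v) x = trigPoly v x := by
  rw [waveSeries, trigPoly, Finsupp.sum, tsum_eq_sum (s := v.support)]
  · rfl
  · intro m hm
    simp [Finsupp.notMem_support_iff.1 hm]

/-- The equation equates the family `p_m^{2l} c_m` with μc - w∗c, which is in ℓ¹. The regularity of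
the solution thus comes from the equation; lower moments follow by comparison. -/
lemma summable_mul_pow_of_isEigenvector {l : ℕ} {w c : Ell1 (Lat n)} {μ : ℝ}
    (he : IsEigenvector l t w μ (toEll2 c)) {k : ℕ} (hk : k ≤ 2 * l) :
    Summable fun m => ‖c m‖ * waveLen m t ^ k := by
  have h : Summable fun m => ‖c m‖ * waveLen m t ^ (2 * l) := by
    refine (summable_norm ((μ : ℂ) • c - conv w c)).congr fun m => ?_
    have h1 := he m
    have h2 : 0 ≤ waveLen m t ^ (2 * l) := pow_nonneg (norm_nonneg _) _
    simp only [toEll2_apply] at h1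
    rw [lp.coeFn_sub, Pi.sub_apply, lp.coeFn_smul, Pi.smul_apply, smul_eq_mul, ← h1, conv_apply,
      add_sub_cancel_right, norm_mul, Complex.norm_real, Real.norm_eq_abs,
      abs_of_nonneg h2, mul_comm]
  refine Summable.of_nonneg_of_le
    (fun m => mul_nonneg (norm_nonneg _) (pow_nonneg (norm_nonneg _) _)) (fun m => ?_)
    ((summable_norm c).add h)
  have h0 : 0 ≤ waveLen m t := norm_nonneg _
  rw [← mul_one_add]
  gcongr
  rcases le_total (waveLen m t) 1 with h1 | h1
  · exact (pow_le_one₀ h0 h1).trans (by linarith [pow_nonneg h0 (2 * l)])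
  · linarith [pow_le_pow_right₀ h1 hk]

/-- A self-consistent eigenvector gives a classical solution of the nonlinear equation. -/
lemma isQuasiperiodicSolution_waveSeries {l : ℕ} {v : Lat n →₀ ℂ} {σ μ : ℝ} {w c : Ell1 (Lat n)}
    (he : IsEigenvector l t w μ (toEll2 c))
    (hw : w = ofFinsupp v + (σ : ℂ) • conv c (reflect c)) :
    IsQuasiperiodicSolution l v σ t (waveSeries t c) μ := by
  have hs := fun k (hk : k ≤ 2 * l) => summable_mul_pow_of_isEigenvector he hk
  refine ⟨contDiff_waveSeries hs, fun x i => ?_, fun x => ?_⟩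
  · rw [waveSeries, waveSeries, ← tsum_mul_left]
    refine tsum_congr fun m => ?_
    rw [planeWave_translate]
    ring
  · rw [iterate_neg_laplacian_waveSeries l hs]
    have h1 : waveSeries t (fun m => (waveLen m t ^ (2 * l) : ℝ) * c m) x =
        evalWave t x ((μ : ℂ) • c - conv w c) := by
      rw [evalWave_apply]
      refine tsum_congr fun m => ?_
      have h1 := he m
      simp only [toEll2_apply] at h1
      rw [lp.coeFn_sub, Pi.sub_apply, lp.coeFn_smul, Pi.smul_apply, smul_eq_mul, ← h1, conv_apply,
        add_sub_cancel_right]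
    have h2 : evalWave t x (conv w c) = waveSeries 0 w x * waveSeries t c x := by
      rw [evalWave_apply, ← waveSeries_conv, zero_add]
    -- The series of `c` and of its reflection have quasimomenta `t` and `-t`, so their product is
    -- periodic.
    have h3 : waveSeries 0 w x = trigPoly v x + σ * ((‖waveSeries t c x‖ ^ 2 : ℝ) : ℂ) := by
      rw [hw, ← evalWave_apply, map_add, map_smul, evalWave_apply, waveSeries_zero_ofFinsupp,
        evalWave_apply, ← add_neg_cancel t, waveSeries_conv, waveSeries_reflect, Complex.mul_conj']
      push_cast
      rfl
    rw [h1, map_sub, map_smul, h2, h3, evalWave_apply, smul_eq_mul]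
    ring

end PlaneWave

/-! ### Eigenvalues of the 2×2 model matrix as functions of its diagonal. -/

/-- The eigenvalue of the matrix `!![x, β; conj β, y]` with sign `s`. -/
def pairEigenvalue (b : ℝ) (s : ℤˣ) (x y : ℝ) : ℝ :=
  (x + y) / 2 + ((s : ℤ) : ℝ) * (Real.sqrt (4 * b ^ 2 + (x - y) ^ 2) / 2)

lemma abs_unit (s : ℤˣ) : |((s : ℤ) : ℝ)| = 1 := by
  rcases Int.units_eq_one_or s with rfl | rfl <;> simp

lemma unit_sq (s : ℤˣ) : ((s : ℤ) : ℝ) ^ 2 = 1 := by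
  rcases Int.units_eq_one_or s with rfl | rfl <;> simp

lemma sqrt_sq_add_sub_le (b d d' : ℝ) :
    |√(4 * b ^ 2 + d ^ 2) - √(4 * b ^ 2 + d' ^ 2)| ≤ |d - d'| := by
  have key : ∀ d d' : ℝ, √(4 * b ^ 2 + d ^ 2) ≤ √(4 * b ^ 2 + d' ^ 2) + |d - d'| := by
    intro d d'
    have h0 := Real.sqrt_nonneg (4 * b ^ 2 + d' ^ 2)
    have h1 : √(4 * b ^ 2 + d' ^ 2) ^ 2 = 4 * b ^ 2 + d' ^ 2 := Real.sq_sqrt (by positivity)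
    have h2 : |d'| ≤ √(4 * b ^ 2 + d' ^ 2) := Real.abs_le_sqrt (by nlinarith [sq_nonneg b])
    refine Real.sqrt_le_iff.2 ⟨by positivity, ?_⟩
    have h3 : |d'| * |d - d'| ≤ √(4 * b ^ 2 + d' ^ 2) * |d - d'| := by gcongr
    have h4 : d' * (d - d') ≤ |d'| * |d - d'| := by rw [← abs_mul]; exact le_abs_self _
    nlinarith [sq_abs (d - d')]
  rw [abs_le]
  have h1 := key d d'
  have h2 := key d' d
  rw [abs_sub_comm] at h2
  constructor <;> linarith

/-- Weyl monotonicity. In the formula, the square root is 1-Lipschitz in the difference of the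
entries, so it changes by no more than the sum of the two excesses over `g`. -/
lemma pairEigenvalue_mono (b : ℝ) (s : ℤˣ) {x y x' y' g : ℝ} (hx : x + g ≤ x') (hy : y + g ≤ y') :
    pairEigenvalue b s x y + g ≤ pairEigenvalue b s x' y' := by
  have h := sqrt_sq_add_sub_le b (x - y) (x' - y')
  have h1 : |x - y - (x' - y')| ≤ (x' - x - g) + (y' - y - g) := by
    rw [abs_le]; constructor <;> linarith
  have h2 := abs_le.1 (h.trans h1)
  rcases Int.units_eq_one_or s with rfl | rfl
  · simp [pairEigenvalue]; linarith
  · simp [pairEigenvalue]; linarith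

lemma pairEigenvalue_near (b : ℝ) (s : ℤˣ) (x y : ℝ) (hb : 0 ≤ b) :
    |pairEigenvalue b s x y - x| ≤ b ∨ |pairEigenvalue b s x y - y| ≤ b := by
  have h1 : √(4 * b ^ 2 + (x - y) ^ 2) ≤ 2 * b + |x - y| :=
    Real.sqrt_le_iff.2 ⟨by positivity, by nlinarith [sq_abs (x - y), abs_nonneg (x - y)]⟩
  have h2 : |x - y| ≤ √(4 * b ^ 2 + (x - y) ^ 2) := Real.abs_le_sqrt (by nlinarith [sq_nonneg b])
  rcases Int.units_eq_one_or s with rfl | rfl <;> rcases le_total x y with h | h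
  · right
    rw [abs_of_nonpos (by linarith)] at h1 h2
    simp only [pairEigenvalue, Units.val_one, Int.cast_one, one_mul, abs_le]
    constructor <;> linarith
  · left
    rw [abs_of_nonneg (by linarith)] at h1 h2
    simp only [pairEigenvalue, Units.val_one, Int.cast_one, one_mul, abs_le]
    constructor <;> linarith
  · left
    rw [abs_of_nonpos (by linarith)] at h1 h2
    simp only [pairEigenvalue, Units.val_neg, Units.val_one, Int.cast_neg, Int.cast_one, abs_le]
    constructor <;> linarith
  · right
    rw [abs_of_nonneg (by linarith)] at h1 h2
    simp only [pairEigenvalue, Units.val_neg, Units.val_one, Int.cast_neg, Int.cast_one, abs_le]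
    constructor <;> linarith

lemma le_abs_sub_pairEigenvalue {b : ℝ} (s : ℤˣ) {x y z g : ℝ} (hb : 0 ≤ b) (hx : g ≤ |z - x|)
    (hy : g ≤ |z - y|) : g - b ≤ |z - pairEigenvalue b s x y| := by
  rcases pairEigenvalue_near b s x y hb with h | h
  · linarith [abs_sub_le z (pairEigenvalue b s x y) x]
  · linarith [abs_sub_le z (pairEigenvalue b s x y) y]

lemma pairEigenvalue_le {b : ℝ} (s : ℤˣ) {x y M : ℝ} (hb : 0 ≤ b) (hx : x ≤ M) (hy : y ≤ M) :
    pairEigenvalue b s x y ≤ M + b := by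
  rcases pairEigenvalue_near b s x y hb with h | h <;> linarith [(abs_le.1 h).2]

/-- The vector (β, L - x), normalized, satisfies the first row identically; the second row is the
characteristic equation. -/
lemma exists_unit_eigenvector (x y : ℝ) (s : ℤˣ) {β : ℂ} (hβ : β ≠ 0) :
    ∃ p r : ℂ, ‖p‖ ^ 2 + ‖r‖ ^ 2 = 1 ∧
      x * p + β * r = (pairEigenvalue ‖β‖ s x y : ℝ) * p ∧
      conj β * p + y * r = (pairEigenvalue ‖β‖ s x y : ℝ) * r := by
  have hchar : (pairEigenvalue ‖β‖ s x y - x) * (pairEigenvalue ‖β‖ s x y - y) = ‖β‖ ^ 2 := by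
    have h1 : √(4 * ‖β‖ ^ 2 + (x - y) ^ 2) ^ 2 = 4 * ‖β‖ ^ 2 + (x - y) ^ 2 :=
      Real.sq_sqrt (by positivity)
    have h2 := unit_sq s
    rw [pairEigenvalue]
    linear_combination (√(4 * ‖β‖ ^ 2 + (x - y) ^ 2) ^ 2 / 4) * h2 + h1 / 4
  set L := pairEigenvalue ‖β‖ s x y
  have hβ' := norm_pos_iff.2 hβ
  set M := √(‖β‖ ^ 2 + (L - x) ^ 2) with hM
  have hMpos : 0 < M := Real.sqrt_pos.2 (by positivity)
  have hMsq : M ^ 2 = ‖β‖ ^ 2 + (L - x) ^ 2 := Real.sq_sqrt (by positivity)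
  have hMc : (M : ℂ) ≠ 0 := by exact_mod_cast hMpos.ne'
  refine ⟨β / M, ((L - x : ℝ) : ℂ) / M, ?_, ?_, ?_⟩
  · rw [norm_div, norm_div, Complex.norm_real, Complex.norm_real, Real.norm_eq_abs,
      Real.norm_eq_abs, div_pow, div_pow, sq_abs, sq_abs, hMsq, ← add_div]
    exact div_self (by positivity)
  · push_cast
    field_simp
    ring
  · have h3 : conj β * β = (((L - x) * (L - y) : ℝ) : ℂ) := by
      rw [hchar, Complex.conj_mul']; push_cast; rfl
    push_cast at h3 ⊢
    field_simp
    linear_combination h3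

/-- The two-level data built from the entries of the model matrix. -/
lemma exists_twoLevel {ι : Type*} {i₀ i₁ : ι} (hne : i₁ ≠ i₀) (a : ι → ℝ) {β : ℂ} (hβ : β ≠ 0)
    (s : ℤˣ) {K : ℝ} (hK : 1 ≤ K) (hβK : 2 * ‖β‖ ≤ K)
    (hgap : ∀ i, i ≠ i₀ → i ≠ i₁ → K ^ 2 + ‖β‖ ≤ |a i - a i₀| ∧ K ^ 2 + ‖β‖ ≤ |a i - a i₁|) :
    ∃ D : TwoLevel ι, D.i₀ = i₀ ∧ D.i₁ = i₁ ∧ D.a = a ∧ D.β = β ∧ D.K = K ∧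
      D.lam = pairEigenvalue ‖β‖ s (a i₀) (a i₁) := by
  obtain ⟨p, r, hu, h₀, h₁⟩ := exists_unit_eigenvector (a i₀) (a i₁) s hβ
  refine ⟨⟨i₀, i₁, a, β, p, r, pairEigenvalue ‖β‖ s (a i₀) (a i₁),
    a i₀ + a i₁ - pairEigenvalue ‖β‖ s (a i₀) (a i₁), K, hne, hu, h₀, h₁, by ring, hβ, ?_, hK, hβK,
    fun i hi₀ hi₁ => ?_⟩, rfl, rfl, rfl, rfl, rfl, rfl⟩
  · have h : a i₀ + a i₁ - pairEigenvalue ‖β‖ s (a i₀) (a i₁) -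
        pairEigenvalue ‖β‖ s (a i₀) (a i₁) =
        -(((s : ℤ) : ℝ) * √(4 * ‖β‖ ^ 2 + (a i₀ - a i₁) ^ 2)) := by
      rw [pairEigenvalue]; ring
    rw [h, abs_neg, abs_mul, abs_unit, one_mul, abs_of_nonneg (Real.sqrt_nonneg _)]
    exact Real.le_sqrt_of_sq_le (by nlinarith [sq_nonneg (a i₀ - a i₁)])
  · have := le_abs_sub_pairEigenvalue (b := ‖β‖) s (norm_nonneg _) (hgap i hi₀ hi₁).1
      (hgap i hi₀ hi₁).2
    linarith

lemma modelEigenvalue_eq {n : ℕ} (l : ℕ) (v : Lat n →₀ ℂ) (q : Lat n) (s : ℤˣ) (j : Lat n)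
    (t : Rn n) : modelEigenvalue l v q s j t =
      pairEigenvalue ‖v q‖ s (waveLen j t ^ (2 * l)) (waveLen (j - q) t ^ (2 * l)) := rfl

/-! ### Elementary estimates for lengths of wave vectors. -/

/-- The factor (u^l - w^l)/(u - w) contains the summand u^(l-1), so no lower bound on `w` beyond
nonnegativity is needed. Applied to squared lengths, it turns the gaps in the resonance condition
into gaps between the diagonal entries. -/
lemma le_abs_pow_sub_pow {u w c : ℝ} {l : ℕ} (hl : 1 ≤ l) (hc : 0 ≤ c) (hu : c ≤ u) (hw : 0 ≤ w) :
    |u - w| * c ^ (l - 1) ≤ |u ^ l - w ^ l| := by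
  obtain ⟨m, rfl⟩ : ∃ m, l = m + 1 := ⟨l - 1, by omega⟩
  have hu0 := hc.trans hu
  rw [Nat.add_sub_cancel]
  have h1 : c ^ m ≤ u ^ m := by gcongr
  rcases le_total w u with h | h
  · have h2 : w ^ m ≤ u ^ m := by gcongr
    have h3 : w ^ (m + 1) ≤ u ^ (m + 1) := by gcongr
    rw [abs_of_nonneg (by linarith), abs_of_nonneg (by linarith)]
    calc (u - w) * c ^ m ≤ (u - w) * u ^ m := mul_le_mul_of_nonneg_left h1 (by linarith)
      _ ≤ u ^ (m + 1) - w ^ (m + 1) := by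
        rw [pow_succ, pow_succ]
        nlinarith
  · have h2 : u ^ m ≤ w ^ m := by gcongr
    have h3 : u ^ (m + 1) ≤ w ^ (m + 1) := by gcongr
    rw [abs_of_nonpos (by linarith), abs_of_nonpos (by linarith)]
    calc -(u - w) * c ^ m ≤ (w - u) * u ^ m := by
          rw [neg_sub]; exact mul_le_mul_of_nonneg_left h1 (by linarith)
      _ ≤ -(u ^ (m + 1) - w ^ (m + 1)) := by
        rw [pow_succ, pow_succ]
        nlinarith

lemma waveVec_add {n : ℕ} (m : Lat n) (t x : Rn n) : waveVec m (t + x) = waveVec m t + x := by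
  ext i; simp [waveVec]; ring

lemma abs_waveLen_sub_le {n : ℕ} (m : Lat n) (t t' : Rn n) :
    |waveLen m t - waveLen m t'| ≤ dist t t' := by
  have h : waveVec m t - waveVec m t' = t - t' := by ext i; simp [waveVec]
  rw [dist_eq_norm, ← h]
  exact abs_norm_sub_norm_le _ _

/-- The squares of lengths that are well separated stay so after a small change. -/
lemma separation_stable {k ρ κ x y z x' y' z' : ℝ} (hk : 16 ≤ k) (hρ : ρ ≤ 1)
    (hρκ : 16 * k * ρ ≤ κ) (hκ : κ ≤ k ^ 2) (hx : x = k) (hy0 : 0 ≤ y) (hz0 : 0 ≤ z)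
    (hz0' : 0 ≤ z') (hy : |y ^ 2 - x ^ 2| ≤ k) (hxx : |x' - x| ≤ ρ) (hyy : |y' - y| ≤ ρ)
    (hzz : |z' - z| ≤ ρ) (hxz : 2 * κ ≤ |x ^ 2 - z ^ 2|) (hyz : 2 * κ ≤ |y ^ 2 - z ^ 2|) :
    κ ≤ |x' ^ 2 - z' ^ 2| ∧ κ ≤ |y' ^ 2 - z' ^ 2| := by
  subst hx
  have hρ0 : 0 ≤ ρ := (abs_nonneg _).trans hxx
  rw [abs_le] at hy
  have hy1 : y ≤ x + 1 := by nlinarith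
  have hy2 : x - 1 ≤ y := by nlinarith
  have hx' := abs_le.1 hxx
  have hy' := abs_le.1 hyy
  have hz' := abs_le.1 hzz
  have key : ∀ {p p' : ℝ}, |p' - p| ≤ ρ → 0 ≤ p → p ≤ x + 1 → 2 * κ ≤ |p ^ 2 - z ^ 2| →
      κ ≤ |p' ^ 2 - z' ^ 2| := by
    intro p p' hpp hp0 hp hpz
    have hp' := abs_le.1 hpp
    -- The change of z² is of order zρ, hence not uniform in `z`. For z ≤ 2x both changes together
    -- stay below 16xρ ≤ κ; for z ≥ 2x the squares differ by at least x² ≥ κ anyway.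
    rcases le_total z (2 * x) with h | h
    · have h1 : |p' ^ 2 - p ^ 2| ≤ ρ * (2 * x + 3) := by
        rw [sq_sub_sq, abs_mul, mul_comm]
        gcongr
        rw [abs_le]; constructor <;> linarith
      have h2 : |z' ^ 2 - z ^ 2| ≤ ρ * (4 * x + 1) := by
        rw [sq_sub_sq, abs_mul, mul_comm]
        gcongr
        rw [abs_le]; constructor <;> linarith
      have h3 : |p ^ 2 - z ^ 2| ≤ |p' ^ 2 - z' ^ 2| + |p' ^ 2 - p ^ 2| + |z' ^ 2 - z ^ 2| := by
        have e : p ^ 2 - z ^ 2 = (p' ^ 2 - z' ^ 2) - (p' ^ 2 - p ^ 2) + (z' ^ 2 - z ^ 2) := by ring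
        rw [e]
        exact (abs_add_le _ _).trans (by gcongr; exact abs_sub _ _)
      nlinarith
    · have h1 : (2 * x - 1) ^ 2 ≤ z' ^ 2 := by gcongr <;> linarith
      have h2 : p' ^ 2 ≤ (x + 2) ^ 2 := by
        apply sq_le_sq'  <;> linarith
      rw [abs_sub_comm]
      refine le_trans ?_ (le_abs_self _)
      nlinarith
  exact ⟨key hxx (by linarith) (by linarith) hxz, key hyy hy0 hy1 hyz⟩

/-! ### Asymptotics near the resonant set. -/

section Geometry

lemma summable_inv_waveLen {n l : ℕ} (hl : n < 2 * l) (t : Rn n) :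
    Summable fun m : Lat n => (1 + waveLen m t ^ (2 * l))⁻¹ := by
  set b := (EuclideanSpace.basisFun (Fin n) ℝ).toBasis
  set L := Submodule.span ℤ (Set.range b)
  have hrank : Module.finrank ℤ L < 2 * l :=
    (finrank_range_le_card (R := ℤ) b).trans_lt (by simpa using hl)
  have hs := ZLattice.summable_norm_sub_inv_pow (L := L) (2 * l) hrank (-t)
  have hmem : ∀ m : Lat n, waveVec m 0 ∈ L := by
    intro m
    have h : waveVec m 0 = ∑ i, m i • b i := by
      ext k
      simp [waveVec, b, Finset.sum_apply, Pi.single_apply]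
    rw [h]
    exact Submodule.sum_mem _ fun i _ => Submodule.smul_mem _ _ (Submodule.subset_span ⟨i, rfl⟩)
  have hinj : Function.Injective fun m : Lat n => (⟨waveVec m 0, hmem m⟩ : L) := by
    intro m m' h
    funext i
    have := congrArg (fun x : Rn n => x i) (Subtype.ext_iff.1 h)
    simpa [waveVec] using this
  have hs' := hs.comp_injective hinj
  have hlen : ∀ m : Lat n, waveLen m t = ‖waveVec m 0 - -t‖ := by
    intro m
    rw [waveLen, sub_neg_eq_add, ← waveVec_add, zero_add]
  -- If P_m(t) = 0, the comparison term is the inverse of 0, which is 0 by convention, and does not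
  -- dominate; at most one `m` has to be left out.
  have hfin : ∀ᶠ m : Lat n in cofinite, waveLen m t ≠ 0 := by
    refine Set.Subsingleton.finite ?_
    intro m hm m' hm'
    simp only [Set.mem_compl_iff, Set.mem_ofPred_eq, not_not, waveLen, norm_eq_zero] at hm hm'
    funext i
    have h := congrArg (fun x : Rn n => x i) (hm.trans hm'.symm)
    simpa [waveVec] using h
  refine Summable.of_norm_bounded_eventually hs' ?_
  filter_upwards [hfin] with m hm
  have h1 : 0 < waveLen m t := lt_of_le_of_ne (norm_nonneg _) hm.symm
  rw [Real.norm_eq_abs, abs_of_pos (by positivity)]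
  simp only [Function.comp_apply, ← hlen, inv_pow]
  exact inv_anti₀ (by positivity) (by linarith)

lemma eventually_le_rpow {x : ℝ} (hx : 0 < x) (M : ℝ) : ∀ᶠ k : ℝ in atTop, M ≤ k ^ x :=
  (tendsto_rpow_atTop hx).eventually_ge_atTop M

variable {n l : ℕ} {δ : ℝ}

/-- Near the resonant set the two diagonal entries of the model matrix are of size `k ^ (2 * l)` and
far from the other diagonal entries. -/
lemma eventually_gap (hn : 1 ≤ n) (hl : n < 2 * l) (hδ : 0 < δ) (hδl : 9 * δ < 2 * (l : ℝ) - n)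
    (g : ℝ) : ∀ᶠ k : ℝ in atTop, ∀ (q j : Lat n), ∀ t ∈ resonantNhd q k δ j,
      (k / 2 ≤ waveLen j t ∧ waveLen j t ≤ 2 * k) ∧
      (k / 2 ≤ waveLen (j - q) t ∧ waveLen (j - q) t ≤ 2 * k) ∧
      ∀ i, i ≠ j → i ≠ j - q →
        g ≤ |waveLen i t ^ (2 * l) - waveLen j t ^ (2 * l)| ∧
        g ≤ |waveLen i t ^ (2 * l) - waveLen (j - q) t ^ (2 * l)| := by
  have hl1 : 1 ≤ l := by omega
  have hn' : (1 : ℝ) ≤ n := by exact_mod_cast hn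
  filter_upwards [eventually_ge_atTop 16, eventually_le_rpow hδ 16,
    eventually_le_rpow (by linarith : 0 < 2 * (l : ℝ) - n - 6 * δ) (g * 4 ^ (l - 1))]
    with k hk hkδ hkg q j t ht
  have hk0 : 0 < k := by linarith
  have hk1 : 1 ≤ k := by linarith
  obtain ⟨-, t₀, ⟨-, hj, hq, hgap⟩, hdist⟩ := ht
  set ρ := k ^ (-(n : ℝ) + 1 - 7 * δ) with hρ
  set κ := k ^ (-(n : ℝ) + 2 - 6 * δ) with hκ
  have hρ1 : ρ ≤ 1 := Real.rpow_le_one_of_one_le_of_nonpos hk1 (by linarith)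
  have hκ1 : κ ≤ k ^ 2 := by
    rw [← Real.rpow_natCast]
    exact Real.rpow_le_rpow_of_exponent_le hk1 (by push_cast; linarith)
  -- The exponents -7δ of the neighborhood and -6δ of the separation differ by δ, and k^δ ≥ 16 pays
  -- for the constant.
  have hρκ : 16 * k * ρ ≤ κ := by
    have h1 : κ = k ^ δ * (k * ρ) := by
      have h2 : k * ρ = k ^ (1 + (-(n : ℝ) + 1 - 7 * δ)) := by
        rw [hρ, Real.rpow_add hk0 1, Real.rpow_one]
      rw [h2, hκ, ← Real.rpow_add hk0]
      ring_nf
    have h2 : 0 ≤ k * ρ := by positivity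
    nlinarith
  have hq1 : |waveLen (j - q) t₀ ^ 2 - waveLen j t₀ ^ 2| ≤ k := by
    refine hq.le.trans ?_
    conv_rhs => rw [← Real.rpow_one k]
    exact Real.rpow_le_rpow_of_exponent_le hk1 (by linarith)
  have hlen0 : ∀ (m : Lat n) (t : Rn n), 0 ≤ waveLen m t := fun m t => norm_nonneg _
  have hd : ∀ m : Lat n, |waveLen m t - waveLen m t₀| ≤ ρ := fun m =>
    (abs_waveLen_sub_le m t t₀).trans hdist.le
  have hdj := abs_le.1 (hd j)
  have hdq := abs_le.1 (hd (j - q))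
  rw [hj] at hdj hq1
  have hq2 := abs_le.1 hq1
  have hy1 : waveLen (j - q) t₀ ≤ k + 1 := by nlinarith [hlen0 (j - q) t₀]
  have hy2 : k - 1 ≤ waveLen (j - q) t₀ := by nlinarith [hlen0 (j - q) t₀]
  have hjk : k / 2 ≤ waveLen j t := by linarith
  have hqk : k / 2 ≤ waveLen (j - q) t := by linarith
  refine ⟨⟨hjk, by linarith⟩, ⟨hqk, by linarith⟩, fun i hi hiq => ?_⟩
  obtain ⟨g1, g2⟩ := hgap i hi hiq
  obtain ⟨h1, h2⟩ := separation_stable hk hρ1 hρκ hκ1 hj (hlen0 _ _) (hlen0 i t₀) (hlen0 i t)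
    (by rw [hj]; exact hq1) (hd j) (hd (j - q)) (hd i) g1.le g2.le
  -- The exponent is (-n + 2 - 6δ) + 2(l - 1), positive because 9δ < 2l - n.
  have hpow : κ * ((k / 2) ^ 2) ^ (l - 1) * 4 ^ (l - 1) = k ^ (2 * (l : ℝ) - n - 6 * δ) := by
    rw [mul_assoc, ← mul_pow]
    have e : (k / 2) ^ 2 * 4 = k ^ 2 := by ring
    rw [e, ← pow_mul, ← Real.rpow_natCast, hκ, ← Real.rpow_add hk0]
    push_cast [hl1]
    ring_nf
  have hfin : g ≤ κ * ((k / 2) ^ 2) ^ (l - 1) := by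
    rw [← hpow] at hkg
    exact le_of_mul_le_mul_right hkg (by positivity)
  have key : ∀ m : Lat n, k / 2 ≤ waveLen m t → κ ≤ |waveLen m t ^ 2 - waveLen i t ^ 2| →
      g ≤ |waveLen i t ^ (2 * l) - waveLen m t ^ (2 * l)| := by
    intro m hm hm2
    rw [abs_sub_comm, pow_mul, pow_mul]
    refine hfin.trans (le_trans ?_ (le_abs_pow_sub_pow hl1 (sq_nonneg (k / 2)) (by gcongr)
      (sq_nonneg _)))
    gcongr
  exact ⟨key j hjk h1, key (j - q) hqk h2⟩

lemma norm_add_smul_sq {P e : Rn n} (he : ‖e‖ = 1) (x : ℝ) :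
    ‖P + x • e‖ ^ 2 = ‖P‖ ^ 2 + 2 * x * ⟪P, e⟫_ℝ + x ^ 2 := by
  rw [norm_add_sq_real, inner_smul_right, norm_smul, he, mul_one, Real.norm_eq_abs, sq_abs]
  ring

/-- Moving along a direction that makes an acute angle with the wave vector changes
the entries of the model matrix by a definite amount. -/
lemma waveLen_pow_shift (hl : 1 ≤ l) {m : Lat n} {t e : Rn n} (he : ‖e‖ = 1) {k x : ℝ}
    (hx0 : 0 ≤ x) (hx1 : x ≤ 1) (hk : 4 ≤ k) (hlen : k / 2 ≤ waveLen m t)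
    (hinner : k / 4 ≤ ⟪waveVec m t, e⟫_ℝ) :
    waveLen m t ^ (2 * l) + k * x / 4 * ((k / 2) ^ 2) ^ (l - 1) ≤
        waveLen m (t + x • e) ^ (2 * l) ∧
      waveLen m (t + (-x) • e) ^ (2 * l) + k * x / 4 * ((k / 2) ^ 2) ^ (l - 1) ≤
        waveLen m t ^ (2 * l) := by
  have h1 := norm_add_smul_sq (P := waveVec m t) he x
  have h2 := norm_add_smul_sq (P := waveVec m t) he (-x)
  rw [← waveVec_add] at h1 h2
  change waveLen m (t + x • e) ^ 2 = waveLen m t ^ 2 + _ + _ at h1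
  change waveLen m (t + (-x) • e) ^ 2 = waveLen m t ^ 2 + _ + _ at h2
  have hp : (k / 2) ^ 2 ≤ waveLen m t ^ 2 := by gcongr
  have g1 : k * x / 4 ≤ waveLen m (t + x • e) ^ 2 - waveLen m t ^ 2 := by
    rw [h1]; nlinarith
  -- The linear term gives kx/2; the quadratic one costs x² ≤ x ≤ kx/4.
  have g2 : k * x / 4 ≤ waveLen m t ^ 2 - waveLen m (t + (-x) • e) ^ 2 := by
    rw [h2]; nlinarith
  have g0 : 0 ≤ k * x / 4 := by positivity
  have a1 := le_abs_pow_sub_pow hl (sq_nonneg (k / 2)) hp (sq_nonneg (waveLen m (t + x • e)))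
  have a2 := le_abs_pow_sub_pow hl (sq_nonneg (k / 2)) hp (sq_nonneg (waveLen m (t + (-x) • e)))
  have b1 : (waveLen m t ^ 2) ^ l ≤ (waveLen m (t + x • e) ^ 2) ^ l :=
    pow_le_pow_left₀ (sq_nonneg _) (by linarith) l
  have b2 : (waveLen m (t + (-x) • e) ^ 2) ^ l ≤ (waveLen m t ^ 2) ^ l :=
    pow_le_pow_left₀ (sq_nonneg _) (by linarith) l
  have c0 : 0 ≤ ((k / 2) ^ 2) ^ (l - 1) := by positivity
  rw [abs_of_nonpos (by linarith), abs_of_nonpos (by linarith)] at a1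
  rw [abs_of_nonneg (by linarith), abs_of_nonneg (by linarith)] at a2
  rw [pow_mul, pow_mul, pow_mul]
  constructor
  · have := mul_le_mul_of_nonneg_right g1 c0
    linarith
  · have := mul_le_mul_of_nonneg_right g2 c0
    linarith

lemma continuous_modelEigenvalue (l : ℕ) (v : Lat n →₀ ℂ) (q : Lat n) (s : ℤˣ) (j : Lat n) :
    Continuous (modelEigenvalue l v q s j) := by
  have h : ∀ m : Lat n, Continuous fun t : Rn n => waveLen m t := by
    intro m
    have : (fun t : Rn n => waveLen m t) = fun t => ‖waveVec m 0 + t‖ := by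
      funext t; rw [waveLen, ← waveVec_add, zero_add]
    rw [this]
    fun_prop
  have h1 := h j
  have h2 := h (j - q)
  unfold modelEigenvalue
  fun_prop

/-- A point near which the model eigenvalue is almost `lam` is close to the model surface. -/
lemma exists_modelEigenvalue_eq (hl : 1 ≤ l) {v : Lat n →₀ ℂ} {q j : Lat n} {s : ℤˣ} {t : Rn n}
    {k x lam : ℝ} (hx0 : 0 ≤ x) (hx1 : x ≤ 1) (hk : 4 ≤ k) (hkq : 4 * ‖waveVec q 0‖ ≤ k)
    (hj : k / 2 ≤ waveLen j t) (hq : k / 2 ≤ waveLen (j - q) t)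
    (hlam : |lam - modelEigenvalue l v q s j t| ≤ k * x / 4 * ((k / 2) ^ 2) ^ (l - 1)) :
    ∃ t', modelEigenvalue l v q s j t' = lam ∧ dist t t' ≤ x := by
  set P := waveVec j t with hP
  have hPpos : 0 < ‖P‖ := by
    have : k / 2 ≤ ‖P‖ := hj
    linarith
  set e : Rn n := ‖P‖⁻¹ • P with he
  have he1 : ‖e‖ = 1 := by rw [he, norm_smul, norm_inv, norm_norm, inv_mul_cancel₀ hPpos.ne']
  have hPe : ⟪P, e⟫_ℝ = ‖P‖ := by
    rw [he, inner_smul_right, real_inner_self_eq_norm_sq]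
    field_simp
  have hQ : waveVec (j - q) t = P - waveVec q 0 := by
    ext i; simp [hP, waveVec]; ring
  -- P_{j-q} differs from P_j by the bounded vector q, so moving along P_j raises both entries; the
  -- intermediate value theorem then applies to either eigenvalue.
  have hQe : k / 4 ≤ ⟪waveVec (j - q) t, e⟫_ℝ := by
    rw [hQ, inner_sub_left, hPe]
    have h1 : ⟪waveVec q 0, e⟫_ℝ ≤ ‖waveVec q 0‖ * ‖e‖ := real_inner_le_norm _ _
    rw [he1, mul_one] at h1
    have : k / 2 ≤ ‖P‖ := hj
    linarith
  have hPe' : k / 4 ≤ ⟪waveVec j t, e⟫_ℝ := by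
    rw [← hP, hPe]
    have : k / 2 ≤ ‖P‖ := hj
    linarith
  obtain ⟨u1, u2⟩ := waveLen_pow_shift hl he1 hx0 hx1 hk hj hPe'
  obtain ⟨w1, w2⟩ := waveLen_pow_shift hl he1 hx0 hx1 hk hq hQe
  have hup := pairEigenvalue_mono ‖v q‖ s u1 w1
  have hdown := pairEigenvalue_mono ‖v q‖ s u2 w2
  simp only [← modelEigenvalue_eq] at hup hdown
  have hlam' := abs_le.1 hlam
  have hcont : Continuous fun y : ℝ => modelEigenvalue l v q s j (t + y • e) :=
    (continuous_modelEigenvalue l v q s j).comp (by fun_prop)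
  obtain ⟨y, hy, hyeq⟩ := intermediate_value_Icc (by linarith : -x ≤ x) hcont.continuousOn
    (show lam ∈ Set.Icc _ _ from ⟨by linarith, by linarith⟩)
  refine ⟨t + y • e, hyeq, ?_⟩
  rw [dist_eq_norm, sub_add_cancel_left, norm_neg, norm_smul, he1, mul_one, Real.norm_eq_abs]
  exact abs_le.2 hy

end Geometry

/-! ### Choice of constants and the nonlinear problem at a fixed quasimomentum. -/

/-- The constants depend only on ‖V‖_* and a lower bound for the nonzero |v_q|, so the final
threshold is uniform in q, t and j. -/
lemma exists_parameters {N b : ℝ} (hN : 0 ≤ N) (hb : 0 < b) :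
    ∃ K ρ κ₀ : ℝ, 1 ≤ K ∧ 2 * N ≤ K ∧ 0 < κ₀ ∧
      ∀ {ι : Type} [DecidableEq ι] [AddCommGroup ι] (D : TwoLevel ι) (v : Ell1 ι), ‖v‖ = N →
        D.K = K → b ≤ ‖D.β‖ → D.IsSmall v ρ ∧
          ∀ κ : ℝ, |κ| < κ₀ → |κ| * 40000 ≤ ρ ∧ |κ| * (400 * 8040 * 1000 * D.τ) ≤ 1 / 2 := by
  set τ₀ := 1 / (2 * b) with hτ₀
  have hτ0 : 0 < τ₀ := by positivity
  -- The first bound gives the contraction, the second the window. Below, ρ and K are chosen so that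
  -- each of the two terms of `smallness` is at most ε/2.
  set ε := min (1 / (2 * (4 * τ₀ + 3))) (b / 40) with hε
  have hε0 : 0 < ε := by positivity
  set ρ := ε / (50 * (1 + τ₀)) with hρ
  set K := 1 + 2 * N + 10 * N * (1 + τ₀) / ε with hK
  have hKN : 0 ≤ 10 * N * (1 + τ₀) / ε := by positivity
  have hK0 : 0 < K := by positivity
  refine ⟨K, ρ, min (ρ / 40000) (1 / (2 * (400 * 8040 * 1000 * τ₀))), by linarith, by linarith,
    by positivity, ?_⟩
  intro ι _ _ D v hv hDK hDb
  have hτ : D.τ ≤ τ₀ := one_div_le_one_div_of_le (by positivity) (by linarith)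
  have hτp := D.τ_pos
  have hsmall : D.smallness v ρ ≤ ε := by
    rw [TwoLevel.smallness, hv, hDK]
    have h1 : 5 * N * K⁻¹ ≤ ε / (2 * (1 + τ₀)) := by
      rw [← div_eq_mul_inv, div_le_div_iff₀ hK0 (by positivity)]
      have h2 : 10 * N * (1 + τ₀) / ε ≤ K := by linarith
      rw [div_le_iff₀ hε0] at h2
      linarith
    calc (1 + D.τ) * (25 * ρ + 5 * N * K⁻¹) ≤
          (1 + τ₀) * (25 * ρ + ε / (2 * (1 + τ₀))) := by gcongr
      _ = ε := by rw [hρ]; field_simp; ring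
  have hs0 : 0 ≤ D.smallness v ρ := (norm_nonneg _).trans
    (D.norm_corrFun_le (v := v) (w := v) (ρ := ρ) (by rw [sub_self, norm_zero]; positivity))
  refine ⟨⟨?_, ?_⟩, fun κ hκ => ⟨?_, ?_⟩⟩
  · calc D.smallness v ρ * (4 * D.τ + 3) ≤ (1 / (2 * (4 * τ₀ + 3))) * (4 * τ₀ + 3) := by
          gcongr
          exact hsmall.trans (min_le_left _ _)
      _ = 1 / 2 := by field_simp
  · have := hsmall.trans (min_le_right _ _)
    linarith
  · have := (hκ.trans_le (min_le_left _ _)).le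
    rw [le_div_iff₀ (by norm_num)] at this
    exact this
  · calc |κ| * (400 * 8040 * 1000 * D.τ) ≤
          1 / (2 * (400 * 8040 * 1000 * τ₀)) * (400 * 8040 * 1000 * τ₀) := by
          gcongr
          exact (hκ.trans_le (min_le_right _ _)).le
      _ = 1 / 2 := by field_simp

namespace Represents

variable {n : ℕ} {D : TwoLevel (Lat n)} {l : ℕ} {v : Lat n →₀ ℂ} {q : Lat n} {s : ℤˣ}
  {j : Lat n} {t : Rn n} (h : Represents D l v q s j t) {ρ : ℝ}

include h

/-- The successive approximations converge and yield a solution of the nonlinear equation. -/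
lemma exists_solution (hv : D.IsCoupling (ofFinsupp v)) (hvr : reflect (ofFinsupp v) = ofFinsupp v)
    (hρ : D.IsSmall (ofFinsupp v) ρ) {σ : ℝ} {A : ℂ}
    (hκ₁ : |σ * ‖A‖ ^ 2| * 40000 ≤ ρ)
    (hκ₂ : |σ * ‖A‖ ^ 2| * (400 * 8040 * 1000 * D.τ) ≤ 1 / 2) :
    ∃ (w : Lat n → ℂ) (μ : ℝ), IsLimitPotential l v q s j t σ A w ∧
      (∀ m, Module.finrank ℂ
        (spectralSubspace l v q s j t (potentialSeq l v q s j t σ A m)) = 1) ∧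
      Module.finrank ℂ (spectralSubspace l v q s j t w) = 1 ∧
      IsNearEigenvalue l v q s j t w μ ∧
      IsQuasiperiodicSolution l v σ t (waveFun l v q s j t A w) μ := by
  obtain ⟨w, hw, hwr, hfix, hseq, hlim⟩ := TwoLevel.exists_limit hρ hvr hκ₁ hκ₂
  set Φ := fun w => D.nextPotential (ofFinsupp v) w (σ * ‖A‖ ^ 2) with hΦ
  have hpot : ∀ m, potentialSeq l v q s j t σ A m = ⇑(Φ^[m] (ofFinsupp v)) := by
    intro m
    induction m with
    | zero => rfl
    | succ m ih =>
      funext i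
      rw [potentialSeq, ih, Function.iterate_succ_apply',
        h.potentialMap_eq hv hρ (hseq m).1 (hseq m).2]
  obtain ⟨μ, hμ, he⟩ := h.isNearEigenvalue hv hρ hw hwr
  refine ⟨w, μ, ⟨fun m => ?_, summable_norm w, ?_⟩, fun m => ?_,
    h.finrank_spectralSubspace hv hρ hw hwr, hμ, ?_⟩
  · rw [hpot]
    exact summable_norm _
  · have h1 := tendsto_iff_norm_sub_tendsto_zero.1 hlim
    refine h1.congr fun m => ?_
    rw [norm_eq, hpot]
    rfl
  · rw [hpot]
    exact h.finrank_spectralSubspace hv hρ (hseq m).1 (hseq m).2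
  · set u := column D.i₀ (D.vec (D.correction (ofFinsupp v) w)) with hu
    have hfun : waveFun l v q s j t A w = waveSeries t (⇑(A • u : Ell1 (Lat n))) := by
      funext x
      rw [waveFun, waveSeries]
      refine tsum_congr fun m => ?_
      rw [h.waveCoeff_eq hv hρ hw hwr, lp.coeFn_smul, Pi.smul_apply, smul_eq_mul, planeWave]
    rw [hfun]
    refine isQuasiperiodicSolution_waveSeries (w := w) ?_ ?_
    · rw [h.isEigenvector_iff] at he ⊢
      rw [hu, column, smul_smul]
      intro m
      have h2 := he m
      rw [map_smul]
      simp only [lp.coeFn_smul, Pi.smul_apply, smul_eq_mul]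
      linear_combination (A * (conj (D.vec (D.correction (ofFinsupp v) w) D.i₀) /
          ((∑' i, ‖D.vec (D.correction (ofFinsupp v) w) i‖ ^ 2 : ℝ) : ℂ))) * h2
    · have h1 : reflect (A • u) = conj A • reflect u := by
        ext m
        simp only [reflect_apply, lp.coeFn_smul, Pi.smul_apply, smul_eq_mul, map_mul]
      have h2 : conv (A • u) (reflect (A • u)) = (A * conj A) • conv u (reflect u) := by
        ext m
        rw [h1, map_smul]
        simp only [lp.coeFn_smul, Pi.smul_apply, smul_eq_mul, conv_apply, ← tsum_mul_left]
        exact tsum_congr fun r => by ring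
      refine hfix.symm.trans ?_
      rw [TwoLevel.nextPotential, ← hu, h2, Complex.mul_conj', smul_smul]
      push_cast
      rfl

end Represents

/-- The right side is of order k^(2l-1-γ), at least k^(l-1/2) and so at least k^(1/2) up to
constants. It is the change of the model eigenvalue over a distance (4k)^(-γ)/2. -/
lemma eventually_margin {l : ℕ} (hl : 1 ≤ l) {γ : ℝ} (hγ : γ ≤ l - 1 / 2) (N : ℝ) :
    ∀ᶠ k : ℝ in atTop, N ≤ k * ((4 * k) ^ (-γ) / 2) / 4 * ((k / 2) ^ 2) ^ (l - 1) := by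
  filter_upwards [eventually_ge_atTop 1,
    eventually_le_rpow (by norm_num : (0 : ℝ) < 1 / 2) (N * (8 * 4 ^ (l - 1) * 4 ^ l))]
    with k hk hkN
  have hk0 : 0 < k := by linarith
  have hl' : (1 : ℝ) ≤ l := by exact_mod_cast hl
  have h1 : (4 : ℝ) ^ (-(l : ℝ)) * k ^ (-((l : ℝ) - 1 / 2)) ≤ (4 * k) ^ (-γ) := by
    calc _ ≤ (4 : ℝ) ^ (-((l : ℝ) - 1 / 2)) * k ^ (-((l : ℝ) - 1 / 2)) := by
          gcongr
          · norm_num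
          · linarith
      _ = (4 * k) ^ (-((l : ℝ) - 1 / 2)) := (Real.mul_rpow (by norm_num) hk0.le).symm
      _ ≤ _ := Real.rpow_le_rpow_of_exponent_le (by linarith) (by linarith)
  have h2 : k * k ^ (-((l : ℝ) - 1 / 2)) * (k ^ 2) ^ (l - 1) = k ^ ((l : ℝ) - 1 / 2) := by
    have h : k * k ^ (-((l : ℝ) - 1 / 2)) = k ^ (1 + -((l : ℝ) - 1 / 2)) := by
      rw [Real.rpow_add hk0 1, Real.rpow_one]
    rw [h, ← pow_mul, ← Real.rpow_natCast, ← Real.rpow_add hk0]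
    push_cast [hl]
    ring_nf
  have h3 : k ^ (1 / 2 : ℝ) ≤ k ^ ((l : ℝ) - 1 / 2) :=
    Real.rpow_le_rpow_of_exponent_le hk (by linarith)
  have h4 : ((k / 2) ^ 2) ^ (l - 1) = (k ^ 2) ^ (l - 1) / 4 ^ (l - 1) := by
    rw [div_pow, div_pow]; norm_num
  have h5 : (4 : ℝ) ^ (-(l : ℝ)) = (4 ^ l)⁻¹ := by
    rw [Real.rpow_neg (by norm_num), Real.rpow_natCast]
  calc N ≤ k ^ ((l : ℝ) - 1 / 2) / (8 * 4 ^ (l - 1) * 4 ^ l) := by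
        rw [le_div_iff₀ (by positivity)]
        exact hkN.trans h3
    _ = k * ((4 : ℝ) ^ (-(l : ℝ)) * k ^ (-((l : ℝ) - 1 / 2)) / 2) / 4 * ((k / 2) ^ 2) ^ (l - 1) := by
        rw [h4, h5, ← h2]
        field_simp
        norm_num
    _ ≤ _ := by gcongr

lemma exists_pos_le_norm {n : ℕ} (v : Lat n →₀ ℂ) : ∃ b > 0, ∀ q, v q ≠ 0 → b ≤ ‖v q‖ := by
  rcases v.support.eq_empty_or_nonempty with h | h
  · exact ⟨1, one_pos, fun q hq => absurd (Finsupp.mem_support_iff.2 hq) (by simp [h])⟩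
  · obtain ⟨q₀, hq₀, hmin⟩ := v.support.exists_min_image (fun q => ‖v q‖) h
    exact ⟨‖v q₀‖, norm_pos_iff.2 (Finsupp.mem_support_iff.1 hq₀),
      fun q hq => hmin q (Finsupp.mem_support_iff.2 hq)⟩

lemma exists_norm_le {n : ℕ} (v : Lat n →₀ ℂ) : ∃ Q : ℝ, ∀ q, v q ≠ 0 → ‖waveVec q 0‖ ≤ Q :=
  ⟨∑ q ∈ v.support, ‖waveVec q 0‖, fun _ hq => Finset.single_le_sum
    (f := fun q : Lat n => ‖waveVec q 0‖) (fun _ _ => norm_nonneg _) (Finsupp.mem_support_iff.2 hq)⟩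

end ResonantPolyharmonic

end

open ResonantPolyharmonic in
theorem mainTheorem4 (n l : ℕ) (hl : n < 2 * l) (v : (Fin n → ℤ) →₀ ℂ) (hv0 : v 0 = 0)
    (hvreal : ∀ m, v (-m) = (starRingEnd ℂ) (v m)) :
    ∃ C : ℝ, 0 < C ∧ ∀ δ γ₂ : ℝ, 0 < δ → 9 * δ < 2 * (l : ℝ) - n → 0 < γ₂ →
      ∃ R : ℝ, 0 < R ∧
        ∀ (q : Fin n → ℤ), v q ≠ 0 → ∀ (s : ℤˣ) (k σ : ℝ) (A : ℂ), R ≤ k →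
          |σ| * ‖A‖ ^ 2 < k ^ (-(2 * (l : ℝ) * γ₂)) →
          (∀ (j : Fin n → ℤ), ∀ t ∈ resonantNhd q k δ j,
            ∃ (w : (Fin n → ℤ) → ℂ) (μ : ℝ),
              IsLimitPotential l v q s j t σ A w ∧
              (∀ m, Module.finrank ℂ
                (spectralSubspace l v q s j t (potentialSeq l v q s j t σ A m)) = 1) ∧
              Module.finrank ℂ (spectralSubspace l v q s j t w) = 1 ∧
              IsNearEigenvalue l v q s j t w μ ∧
              IsQuasiperiodicSolution l v σ t (waveFun l v q s j t A w) μ) ∧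
          ∀ lam : ℝ, R ≤ lam → ∀ j : Fin n → ℤ,
            nonlinearSurface l v q s k δ σ A j lam ⊆
              Metric.thickening (C * lam ^ (-(gammaExp n l δ γ₂ / (2 * l))))
                (modelSurface l v q s j lam) := by
  refine ⟨1, one_pos, fun δ γ₂ hδ hδl hγ₂ => ?_⟩
  have hl1 : 1 ≤ l := by omega
  have hl' : (1 : ℝ) ≤ l := by exact_mod_cast hl1
  -- For n = 0 the only index is 0, where `v` vanishes, so no `q` is admissible.
  rcases Nat.eq_zero_or_pos n with rfl | hn
  · exact ⟨1, one_pos, fun q hq => absurd (by rw [Subsingleton.elim q 0, hv0]) hq⟩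
  have hn' : (1 : ℝ) ≤ n := by exact_mod_cast hn
  obtain ⟨b, hb, hbv⟩ := exists_pos_le_norm v
  obtain ⟨Q, hQ⟩ := exists_norm_le v
  set N := ‖ofFinsupp v‖ with hN
  have hN0 : 0 ≤ N := norm_nonneg _
  have hvN : ∀ q, ‖v q‖ ≤ N := fun q => Ell1.norm_apply_le (ofFinsupp v) q
  have hvr : Ell1.reflect (ofFinsupp v) = ofFinsupp v := by
    ext m
    rw [Ell1.reflect_apply, ofFinsupp_apply, ofFinsupp_apply, hvreal, Complex.conj_conj]
  obtain ⟨K, ρ, κ₀, hK1, hKN, hκ₀, hpar⟩ := exists_parameters hN0 hb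
  set γ := gammaExp n l δ γ₂ with hγ
  -- Only γ ≤ γ₁ = l - n/2 - 4δ and n ≥ 1 are used.
  have hγ1 : γ ≤ l - 1 / 2 := (min_le_left _ _).trans (by linarith)
  have hγ0 : 0 < γ := lt_min (by linarith) (by positivity)
  have hκev : ∀ᶠ k : ℝ in Filter.atTop, k ^ (-(2 * (l : ℝ) * γ₂)) < κ₀ :=
    (tendsto_rpow_neg_atTop (by positivity : 0 < 2 * (l : ℝ) * γ₂)).eventually_lt_const hκ₀
  obtain ⟨R₀, hR₀⟩ := Filter.eventually_atTop.1 ((Filter.eventually_ge_atTop 4).and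
    ((Filter.eventually_ge_atTop (4 * Q)).and ((Filter.eventually_ge_atTop N).and
    (hκev.and ((eventually_gap hn hl hδ hδl (K ^ 2 + N)).and (eventually_margin hl1 hγ1 N))))))
  refine ⟨max R₀ 1, by positivity, fun q hq s k σ A hk hσ => ?_⟩
  obtain ⟨hk4, hkQ, hkN, hkκ, hgap, hmargin⟩ := hR₀ k ((le_max_left _ _).trans hk)
  have hq0 : q ≠ 0 := by rintro rfl; exact hq hv0
  refine ⟨fun j t ht => ?_, fun lam hlam j t ht => ?_⟩
  · obtain ⟨-, -, hg⟩ := hgap q j t ht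
    obtain ⟨D, h₀, h₁, ha, hβ, hDK, hlam⟩ := exists_twoLevel (i₀ := j) (i₁ := j - q)
      (by simpa [sub_eq_self] using hq0) (fun m => waveLen m t ^ (2 * l)) hq s hK1
      (by linarith [hvN q]) fun i hi hi' => by
        obtain ⟨g1, g2⟩ := hg i hi hi'
        exact ⟨by linarith [hvN q], by linarith [hvN q]⟩
    have hrep : Represents D l v q s j t :=
      ⟨h₀, h₁, fun m => by rw [ha], hβ, hlam, summable_inv_waveLen hl t⟩
    obtain ⟨hsmall, hκ⟩ := hpar D (ofFinsupp v) rfl hDK (by rw [hβ]; exact hbv q hq)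
    obtain ⟨hκ₁, hκ₂⟩ := hκ (σ * ‖A‖ ^ 2) (by
      rw [abs_mul, abs_of_nonneg (sq_nonneg ‖A‖)]
      exact hσ.trans hkκ)
    exact hrep.exists_solution (hrep.isCoupling hv0 hvreal) hvr hsmall hκ₁ hκ₂
  · obtain ⟨htn, w, -, hnear, -⟩ := ht
    obtain ⟨⟨hj1, hj2⟩, ⟨hq1, hq2⟩, -⟩ := hgap q j t htn
    have hlam0 : 0 < lam := lt_of_lt_of_le one_pos ((le_max_right _ _).trans hlam)
    have hk0 : 0 < k := by linarith
    have hx1 : (4 * k) ^ (-γ) ≤ 1 :=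
      Real.rpow_le_one_of_one_le_of_nonpos (by linarith) (by linarith)
    have hx0 : 0 < (4 * k) ^ (-γ) := by positivity
    -- Half of (4k)^(-γ) is taken so that the final distance bound is strict.
    obtain ⟨t', ht', hdist⟩ := exists_modelEigenvalue_eq hl1 (v := v) (s := s)
      (x := (4 * k) ^ (-γ) / 2) (by positivity) (by linarith) hk4 (by linarith [hQ q hq]) hj1 hq1
      (lam := lam) (by linarith [hvN q])
    refine Metric.mem_thickening_iff.2 ⟨t', ht', hdist.trans_lt ?_⟩
    have hupper : modelEigenvalue l v q s j t ≤ (2 * k) ^ (2 * l) + N := by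
      rw [modelEigenvalue_eq]
      have hlen : ∀ m : Fin n → ℤ, waveLen m t ≤ 2 * k → waveLen m t ^ (2 * l) ≤ (2 * k) ^ (2 * l) :=
        fun m hm => pow_le_pow_left₀ (norm_nonneg _) hm _
      linarith [pairEigenvalue_le s (norm_nonneg (v q)) (hlen _ hj2) (hlen _ hq2), hvN q]
    have hpow : (2 * k) ^ (2 * l) + 2 * N ≤ (4 * k) ^ (2 * l) := by
      have h1 : 2 * k ≤ (2 * k) ^ (2 * l) := le_self_pow₀ (by linarith) (by omega)
      have h2 : (2 : ℝ) ≤ 2 ^ (2 * l) := le_self_pow₀ (by norm_num) (by omega)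
      have h3 : (4 * k) ^ (2 * l) = 2 ^ (2 * l) * (2 * k) ^ (2 * l) := by
        rw [← mul_pow]; ring
      rw [h3]
      nlinarith
    -- An upper bound for `lam` in terms of `k` is what is needed: the exponent of `lam` is
    -- negative, so it turns (4k)^(-γ) into a lower bound for the radius with C = 1.
    have hlamle : lam ≤ (4 * k) ^ (2 * l) := by
      linarith [(abs_lt.1 hnear).2, hvN q]
    have hexp : ((4 * k) ^ (2 * l)) ^ (-(γ / (2 * l))) = (4 * k) ^ (-γ) := by
      rw [← Real.rpow_natCast, ← Real.rpow_mul (by positivity)]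
      congr 1
      push_cast
      field_simp
    rw [one_mul]
    calc (4 * k) ^ (-γ) / 2 < (4 * k) ^ (-γ) := by linarith
      _ = ((4 * k) ^ (2 * l)) ^ (-(γ / (2 * l))) := hexp.symm
      _ ≤ lam ^ (-(γ / (2 * l))) :=
        Real.rpow_le_rpow_of_nonpos hlam0 hlamle (neg_nonpos.2 (by positivity))
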